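/- Let $I$ be a finite nonempty index set with $|I|=n$, and let $\{X_\alpha\}_{\alpha\in I}$ be independent Bernoulli random variables with $p_\alpha \triangleq \Pr(X_\alpha=1)=1-\Pr(X_\alpha=0)>0$. Let $W=\sum_{\alpha\in I}X_\alpha$, $$\lambda=\sum_{\alpha\in I}p_\alpha,\qquad \theta=\frac1\lambda\sum_{\alpha\in I}p_\alpha^2,\qquad \eta=\theta\,\min\left\{1-e^{-\lambda},\ \frac{3}{4e\,(1-\sqrt\theta)^{3/2}}\right\},$$ where, if $\theta=1$, the second term of the minimum is read as $+\infty$. Let $$M=\max\left\{n+2,\ \frac1{1-\eta}\right\},$$ $$\mu=\left[\Bigl(\lambda\log\frac e\lambda\Bigr)_+ +\lambda^2+\frac{6\log(2\pi)+1}{12}\right]\exp\left\{-\left[\lambda+(M-2)\log\left(\frac{M-2}{\lambda e}\right)\right]\right\},$$ where $(x)_+=\max\{x,0\}$, and let $Z$ be a Poisson random variable with mean $\lambda$. Then the Shannon entropies $H(W)$ and $H(Z)$ (in nats) are finite and $$0\le H(Z)-H(W)\le \eta\log(M-1)+h(\eta)+\mu,$$ where $h(x)=-x\log x-(1-x)\log(1-x)$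 is the binary entropy function (in nats, with $0\log 0=0$). -/

import Mathlib

open MeasureTheory ProbabilityTheory

noncomputable section

/-- The terms `-P(Y = k) log P(Y = k)` of the Shannon entropy (in nats) of a random variable `Y`
with values in `ℕ`, where `0 log 0 = 0`. -/
def entropyTerm {Ω : Type*} [MeasurableSpace Ω] (P : Measure Ω) (Y : Ω → ℕ) (k : ℕ) : ℝ :=
  Real.negMulLog (P.real {ω | Y ω = k})

/-- The Shannon entropy (in nats) of a random variable with values in `ℕ`. -/
def shannonEntropy {Ω : Type*} [MeasurableSpace Ω] (P : Measure Ω) (Y : Ω → ℕ) : ℝ :=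
  ∑' k : ℕ, entropyTerm P Y k

/-- `λ = ∑ p_α`. -/
def sumMean {I : Type*} [Fintype I] (p : I → ℝ) : ℝ := ∑ α, p α

/-- `θ = (∑ p_α²) / λ`. -/
def thetaParam {I : Type*} [Fintype I] (p : I → ℝ) : ℝ := (∑ α, p α ^ 2) / sumMean p

/-- `η = θ min {1 - e^{-λ}, 3 / (4 e (1 - √θ)^{3/2})}`. If `θ = 1` (all the `p_α` are `1`),
the second term of the minimum has denominator zero and is read as `+∞`. -/
def etaParam (lam θ : ℝ) : ℝ :=
  if θ = 1 then θ * (1 - Real.exp (-lam))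
  else θ * min (1 - Real.exp (-lam))
    (3 / (4 * Real.exp 1 * (1 - Real.sqrt θ) ^ (3 / 2 : ℝ)))

/-- `M = max {n + 2, 1 / (1 - η)}`. -/
def bigM (n : ℕ) (η : ℝ) : ℝ := max ((n : ℝ) + 2) (1 / (1 - η))

/-- `μ = [(λ log (e / λ))₊ + λ² + (6 log (2π) + 1) / 12]
exp {-[λ + (M - 2) log ((M - 2) / (λ e))]}`. -/
def muParam (lam M : ℝ) : ℝ :=
  (max (lam * Real.log (Real.exp 1 / lam)) 0 + lam ^ 2
      + (6 * Real.log (2 * Real.pi) + 1) / 12)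
    * Real.exp (-(lam + (M - 2) * Real.log ((M - 2) / (lam * Real.exp 1))))

end

/-! Write w for the law of W, π for the Poisson law, φ(x) = -x log x, and d for the total variation
distance of w and π.

Lower bound. Since -log π_k is convex in k and a Bernoulli sum is smaller than Z in the convex
order, H(W) ≤ -E log π(W) ≤ -E log π(Z) = H(Z) (`entropy_bernSer_le`, `bernExp_le_poisson`).

Upper bound. Split π = min(w, π) + (π - w)₊ below a truncation point m. Subadditivity of φ bounds
the entropy of π there by that of the two parts: the common part costs at most H(W) + φ(1 - d), and
the excess vanishes at some point below m, so it costs about φ(d) + d log(m - 1). This gives h(d) +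
d log(m - 1) plus a tail entropy (`entropy_sub_le`). The tail is at most μ by Stirling and Chernoff,
and d may be replaced by η because h(x) + x log(M - 1) increases up to 1 - 1/M ≥ η.

It remains that d ≤ η (`bernTV_le_etaParam`). The bound θ(1 - e^{-λ}) is Stein's method. The other
one comes from the expansion w = ∑ a_j Δ^j π in backward differences of π, where ∏(1 + p_i Y)
e^{-p_i Y} = ∑ a_j Y^j. Here a_0 = 1 and a_1 = 0; the ℓ¹ norm of Δ²π is bounded by the sharp 3/(eλ),
and the terms with j ≥ 3 by orthogonality of the Charlier polynomials and Cauchy's estimate for a_j.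
-/

/-! ### Poisson weights, tails and the Chernoff bound. -/

/-- The Poisson weights `e^{-l} l^k / k!`. -/
noncomputable def poisWt (l : ℝ) (k : ℕ) : ℝ := Real.exp (-l) * l ^ k / (k.factorial : ℝ)

lemma poisWt_nonneg {l : ℝ} (hl : 0 ≤ l) (k : ℕ) : 0 ≤ poisWt l k := by
  unfold poisWt; positivity

lemma poisWt_pos {l : ℝ} (hl : 0 < l) (k : ℕ) : 0 < poisWt l k := by
  unfold poisWt; positivity

lemma hasSum_pow_div_factorial (l : ℝ) :
    HasSum (fun k : ℕ => l ^ k / (k.factorial : ℝ)) (Real.exp l) := by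
  rw [Real.exp_eq_exp_ℝ]
  exact NormedSpace.expSeries_div_hasSum_exp l

lemma hasSum_poisWt (l : ℝ) : HasSum (poisWt l) 1 := by
  have h := (hasSum_pow_div_factorial l).mul_left (Real.exp (-l))
  rw [← Real.exp_add, neg_add_cancel, Real.exp_zero] at h
  refine h.congr_fun ?_
  intro k
  simp only [poisWt, mul_div_assoc]

lemma summable_poisWt (l : ℝ) : Summable (poisWt l) := (hasSum_poisWt l).summable

lemma tsum_poisWt (l : ℝ) : ∑' k, poisWt l k = 1 := (hasSum_poisWt l).tsum_eq

lemma poisWt_zero (l : ℝ) : poisWt l 0 = Real.exp (-l) := by simp [poisWt]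

lemma succ_mul_poisWt_succ (l : ℝ) (k : ℕ) :
    ((k : ℝ) + 1) * poisWt l (k + 1) = l * poisWt l k := by
  unfold poisWt
  rw [Nat.factorial_succ]
  push_cast
  field_simp
  ring

lemma poisWt_succ (l : ℝ) (k : ℕ) : poisWt l (k + 1) = l / (k + 1) * poisWt l k := by
  have h := succ_mul_poisWt_succ l k
  field_simp
  linarith

lemma poisWt_le_one {l : ℝ} (hl : 0 ≤ l) (k : ℕ) : poisWt l k ≤ 1 := by
  rw [← tsum_poisWt l]
  exact (summable_poisWt l).le_tsum k fun j _ => poisWt_nonneg hl j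

/-- The tail probabilities `P(Z ≥ m)` of the Poisson law. -/
noncomputable def poisTail (l : ℝ) (m : ℕ) : ℝ := ∑' k, poisWt l (k + m)

lemma summable_poisWt_add (l : ℝ) (m : ℕ) : Summable fun k => poisWt l (k + m) :=
  (summable_nat_add_iff m).2 (summable_poisWt l)

lemma poisTail_nonneg {l : ℝ} (hl : 0 ≤ l) (m : ℕ) : 0 ≤ poisTail l m :=
  tsum_nonneg fun _ => poisWt_nonneg hl _

lemma poisTail_zero (l : ℝ) : poisTail l 0 = 1 := by simpa [poisTail] using tsum_poisWt l

lemma poisTail_eq_add (l : ℝ) (m : ℕ) : poisTail l m = poisWt l m + poisTail l (m + 1) := by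
  unfold poisTail
  rw [(summable_poisWt_add l m).tsum_eq_zero_add]
  simp only [zero_add]
  congr 2
  ext k
  congr 1
  ring

lemma sum_range_add_poisTail (l : ℝ) (m : ℕ) :
    ∑ k ∈ Finset.range m, poisWt l k + poisTail l m = 1 := by
  rw [← tsum_poisWt l]
  exact (summable_poisWt l).sum_add_tsum_nat_add m

lemma poisTail_antitone {l : ℝ} (hl : 0 ≤ l) : Antitone (poisTail l) := by
  refine antitone_nat_of_succ_le fun m => ?_
  rw [poisTail_eq_add l m]
  linarith [poisWt_nonneg hl m]

/-- By k π_k = l π_{k-1}, each factor of a falling factorial becomes a factor l and a shift of the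
tail index. These truncated factorial moments evaluate the majorants of the tail entropy. -/
lemma hasSum_mul_poisWt_add (l : ℝ) (m : ℕ) :
    HasSum (fun k : ℕ => ((k + (m + 1) : ℕ) : ℝ) * poisWt l (k + (m + 1))) (l * poisTail l m) := by
  have h := (summable_poisWt_add l m).hasSum.mul_left l
  refine h.congr_fun ?_
  intro k
  rw [← succ_mul_poisWt_succ, ← add_assoc]
  push_cast
  ring

lemma hasSum_mul_mul_poisWt_add (l : ℝ) (m : ℕ) :
    HasSum (fun k : ℕ => ((k + (m + 2) : ℕ) : ℝ) * (((k + (m + 2) : ℕ) : ℝ) - 1) *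
      poisWt l (k + (m + 2))) (l ^ 2 * poisTail l m) := by
  have h := (hasSum_mul_poisWt_add l m).mul_left l
  rw [← mul_assoc, ← sq] at h
  refine h.congr_fun ?_
  intro k
  have e := succ_mul_poisWt_succ l (k + (m + 1))
  rw [show k + (m + 2) = k + (m + 1) + 1 by ring]
  push_cast at e ⊢
  linear_combination ((k : ℝ) + (m + 1)) * e

/-- Chernoff bound for the upper tail of the Poisson law. -/
lemma poisTail_le_chernoff {l r : ℝ} (hl : 0 < l) (hr : l ≤ r) {m : ℕ} (hm : r ≤ m) :
    poisTail l m ≤ Real.exp (-(l + r * Real.log (r / (l * Real.exp 1)))) := by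
  have hr0 : 0 < r := hl.trans_le hr
  -- This tilt minimises t^(-r) e^{l(t - 1)}, the Chernoff bound from E t^Z. The real r may lie
  -- below the integer m because t ≥ 1.
  set t : ℝ := r / l with ht
  have ht1 : 1 ≤ t := by rw [ht, le_div_iff₀ hl]; linarith
  have ht0 : 0 < t := by linarith
  have hs : HasSum (fun k => t ^ k * poisWt l k) (Real.exp (r - l)) := by
    have h := (hasSum_pow_div_factorial r).mul_left (Real.exp (-l))
    rw [← Real.exp_add, show -l + r = r - l by ring] at h
    refine h.congr_fun ?_
    intro k
    have : r ^ k = t ^ k * l ^ k := by rw [← mul_pow, ht]; congr 1; field_simp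
    rw [this, poisWt]
    ring
  have h1 : ∀ k, poisWt l (k + m) ≤ t ^ (-r) * (t ^ (k + m) * poisWt l (k + m)) := by
    intro k
    have : 1 ≤ t ^ (-r) * t ^ (k + m) := by
      rw [← Real.rpow_natCast, ← Real.rpow_add ht0]
      apply Real.one_le_rpow ht1
      push_cast
      have : (0 : ℝ) ≤ k := Nat.cast_nonneg k
      linarith
    nlinarith [poisWt_nonneg hl.le (k + m)]
  have hs2 : Summable fun k => t ^ (k + m) * poisWt l (k + m) :=
    (summable_nat_add_iff m).2 hs.summable
  have h2 : poisTail l m ≤ t ^ (-r) * ∑' k, t ^ (k + m) * poisWt l (k + m) := by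
    rw [← tsum_mul_left]
    exact (summable_poisWt_add l m).tsum_le_tsum h1 (hs2.mul_left _)
  have h3 : ∑' k, t ^ (k + m) * poisWt l (k + m) ≤ Real.exp (r - l) := by
    have := hs.summable.sum_add_tsum_nat_add m
    rw [hs.tsum_eq] at this
    have h4 : 0 ≤ ∑ k ∈ Finset.range m, t ^ k * poisWt l k :=
      Finset.sum_nonneg fun k _ => mul_nonneg (by positivity) (poisWt_nonneg hl.le k)
    linarith
  refine h2.trans ((mul_le_mul_of_nonneg_left h3 (Real.rpow_nonneg ht0.le _)).trans_eq ?_)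
  rw [Real.rpow_def_of_pos ht0, ← Real.exp_add]
  congr 1
  rw [ht, Real.log_div hr0.ne' hl.ne', Real.log_div hr0.ne' (by positivity),
    Real.log_mul hl.ne' (by positivity), Real.log_exp]
  ring

/-! ### Stirling bounds and elementary inequalities for exp and log. -/

lemma stirlingSeq_le_one {k : ℕ} (hk : k ≠ 0) :
    Stirling.stirlingSeq k ≤ Real.exp 1 / Real.sqrt 2 := by
  rw [← Stirling.stirlingSeq_one]
  obtain ⟨j, rfl⟩ := Nat.exists_eq_succ_of_ne_zero hk
  exact Stirling.stirlingSeq'_antitone (Nat.zero_le j)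

lemma factorial_le_stirling {k : ℕ} (hk : k ≠ 0) :
    (k.factorial : ℝ) ≤ Real.exp 1 * Real.sqrt k * (k / Real.exp 1) ^ k := by
  have h := stirlingSeq_le_one hk
  have hk0 : (0 : ℝ) < k := by positivity
  rw [Stirling.stirlingSeq, div_le_iff₀ (by positivity)] at h
  refine h.trans_eq ?_
  rw [Real.sqrt_mul (by norm_num)]
  field_simp

/-- `factorial_le_stirling` gives the additive constant 1. The constant ½ log 2π + 1/12 ≈ 1.002 of
`muParam` barely exceeds it; this is 6 log 2π ≥ 11, checked as e^11 ≤ (2π)^6. -/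
lemma log_factorial_le_stirling {k : ℕ} (hk : k ≠ 0) :
    Real.log k.factorial ≤ k * Real.log k - k + Real.log k / 2 +
      (6 * Real.log (2 * Real.pi) + 1) / 12 := by
  have hk0 : (0 : ℝ) < k := by positivity
  have h := Real.log_le_log (by positivity) (factorial_le_stirling hk)
  rw [Real.log_mul (by positivity) (by positivity), Real.log_mul (by positivity) (by positivity),
    Real.log_exp, Real.log_sqrt hk0.le, Real.log_pow, Real.log_div hk0.ne' (by positivity),
    Real.log_exp] at h
  have h2 : (11 : ℝ) ≤ 6 * Real.log (2 * Real.pi) := by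
    have h6 : 6 * Real.log (2 * Real.pi) = Real.log ((2 * Real.pi) ^ 6) := by
      rw [Real.log_pow]; norm_num
    rw [h6, Real.le_log_iff_exp_le (by positivity)]
    have e1 : Real.exp 11 = Real.exp 1 ^ 11 := by rw [← Real.exp_nat_mul]; norm_num
    rw [e1]
    calc Real.exp 1 ^ 11 ≤ 2.7182818286 ^ 11 :=
          pow_le_pow_left₀ (by positivity) Real.exp_one_lt_d9.le _
      _ ≤ (2 * 3.1415) ^ 6 := by norm_num
      _ ≤ (2 * Real.pi) ^ 6 := by
          apply pow_le_pow_left₀ (by norm_num)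
          linarith [Real.pi_gt_d4]
  linarith

lemma exp_le_quadratic_of_nonpos {y : ℝ} (hy : y ≤ 0) : Real.exp y ≤ 1 + y + y ^ 2 / 2 := by
  have hd : ∀ x : ℝ, HasDerivAt (fun x => 1 + x + x ^ 2 / 2 - Real.exp x) (1 + x - Real.exp x) x := by
    intro x
    have h := ((((hasDerivAt_id x).const_add 1).add ((hasDerivAt_pow 2 x).div_const 2)).sub
      (Real.hasDerivAt_exp x))
    refine h.congr_deriv ?_
    norm_num
  have ha : Antitone fun x : ℝ => 1 + x + x ^ 2 / 2 - Real.exp x := by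
    refine antitone_of_deriv_nonpos (fun x => (hd x).differentiableAt) fun x => ?_
    rw [(hd x).deriv]
    linarith [Real.add_one_le_exp x]
  have := ha hy
  simp at this
  linarith

/-- The next Taylor term has even order, so the bound holds for both signs of y and exp can be
expanded about any convenient point. -/
lemma cubic_le_exp (y : ℝ) : 1 + y + y ^ 2 / 2 + y ^ 3 / 6 ≤ Real.exp y := by
  rcases le_total 0 y with hy | hy
  · have h := Real.sum_le_exp_of_nonneg hy 4
    simp only [Finset.sum_range_succ, Finset.sum_range_zero, Nat.factorial] at h
    norm_num at h
    linarith
  have hd : ∀ x : ℝ, HasDerivAt (fun x => Real.exp x - (1 + x + x ^ 2 / 2 + x ^ 3 / 6))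
      (Real.exp x - (1 + x + x ^ 2 / 2)) x := by
    intro x
    have h := (Real.hasDerivAt_exp x).sub ((((hasDerivAt_id x).const_add 1).add
      ((hasDerivAt_pow 2 x).div_const 2)).add ((hasDerivAt_pow 3 x).div_const 6))
    refine h.congr_deriv ?_
    norm_num
    ring
  have ha : AntitoneOn (fun x : ℝ => Real.exp x - (1 + x + x ^ 2 / 2 + x ^ 3 / 6)) (Set.Iic 0) := by
    refine antitoneOn_of_deriv_nonpos (convex_Iic 0)
      (fun x _ => (hd x).continuousAt.continuousWithinAt)
      (fun x _ => (hd x).differentiableAt.differentiableWithinAt) fun x hx => ?_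
    rw [(hd x).deriv]
    rw [interior_Iic] at hx
    linarith [exp_le_quadratic_of_nonpos (le_of_lt hx)]
  have := ha (Set.mem_Iic.2 hy) (Set.mem_Iic.2 le_rfl) hy
  simp at this
  linarith

lemma log_one_sub_le {u : ℝ} (h0 : 0 ≤ u) (h1 : u < 1) : Real.log (1 - u) ≤ -u - u ^ 2 / 2 := by
  have h := Real.hasSum_pow_div_log_of_abs_lt_one (x := u) (by rw [abs_of_nonneg h0]; exact h1)
  have h2 := sum_le_hasSum (Finset.range 2) (fun i _ => by positivity) h
  simp [Finset.sum_range_succ] at h2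
  norm_num at h2
  linarith

/-- This rational majorant agrees with log(1 + u) to third order and, unlike the cubic Taylor
polynomial, stays useful for large u. -/
lemma log_one_add_le {u : ℝ} (hu : 0 ≤ u) :
    Real.log (1 + u) ≤ u - 3 * u ^ 2 / (6 + 4 * u) := by
  have hd : ∀ x : ℝ, 0 ≤ x → HasDerivAt (fun x => x - 3 * x ^ 2 / (6 + 4 * x) - Real.log (1 + x))
      (1 - (3 * (2 * x) * (6 + 4 * x) - 3 * x ^ 2 * 4) / (6 + 4 * x) ^ 2 - 1 / (1 + x)) x := by
    intro x hx
    have h1 : HasDerivAt (fun x : ℝ => 6 + 4 * x) 4 x := by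
      simpa using ((hasDerivAt_id x).const_mul 4).const_add 6
    have h2 : HasDerivAt (fun x : ℝ => 3 * x ^ 2) (3 * (2 * x)) x := by
      simpa using (hasDerivAt_pow 2 x).const_mul 3
    have h3 : HasDerivAt (fun x : ℝ => Real.log (1 + x)) (1 / (1 + x)) x :=
      ((hasDerivAt_id x).const_add 1).log (by simp; linarith)
    exact ((hasDerivAt_id x).sub (h2.div h1 (by linarith))).sub h3
  have hm : MonotoneOn (fun x : ℝ => x - 3 * x ^ 2 / (6 + 4 * x) - Real.log (1 + x))
      (Set.Ici 0) := by
    refine monotoneOn_of_deriv_nonneg (convex_Ici 0)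
      (fun x hx => (hd x hx).continuousAt.continuousWithinAt) (fun x hx => ?_) fun x hx => ?_
    · rw [interior_Ici] at hx
      exact (hd x (le_of_lt hx)).differentiableAt.differentiableWithinAt
    · rw [interior_Ici] at hx
      have hx0 : 0 < x := hx
      rw [(hd x hx0.le).deriv]
      have : 1 - (3 * (2 * x) * (6 + 4 * x) - 3 * x ^ 2 * 4) / (6 + 4 * x) ^ 2 - 1 / (1 + x)
          = 4 * x ^ 3 / ((6 + 4 * x) ^ 2 * (1 + x)) := by
        field_simp
        ring
      rw [this]
      positivity
  have := hm (Set.mem_Ici.2 le_rfl) (Set.mem_Ici.2 hu) hu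
  simp at this
  linarith

/-! ### Sharp numerical bounds for |k - l| π_k. -/

lemma poisWt_le_stirling {l : ℝ} (hl : 0 < l) {k : ℕ} (hk : k ≠ 0) :
    poisWt l k ≤ Real.exp (k - l + k * Real.log (l / k)) / (Real.sqrt (2 * Real.pi) * Real.sqrt k) := by
  have hk0 : (0 : ℝ) < k := by positivity
  have h := Stirling.le_factorial_stirling k
  rw [Real.sqrt_mul (by positivity)] at h
  have h1 : Real.exp (k - l + k * Real.log (l / k)) =
      Real.exp (-l) * l ^ k / (k / Real.exp 1) ^ k := by
    rw [show (k : ℝ) - l + k * Real.log (l / k) = -l + (k * 1 + k * Real.log (l / k)) by ring,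
      Real.exp_add, Real.exp_add, Real.exp_nat_mul, Real.exp_nat_mul, Real.exp_log (by positivity), ← mul_pow,
      mul_div_assoc, ← div_pow]
    congr 2
    field_simp
  rw [h1, poisWt, div_div]
  apply div_le_div_of_nonneg_left (by positivity) (by positivity)
  linarith

lemma sqrt_two_pi_ge : (2.5065 : ℝ) ≤ Real.sqrt (2 * Real.pi) := by
  apply Real.le_sqrt_of_sq_le
  have := Real.pi_gt_d4
  norm_num at this ⊢
  linarith

lemma mul_exp_neg_half_sq_le (t : ℝ) : t * Real.exp (-(t ^ 2 / 2)) ≤ Real.exp (-(1 / 2)) := by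
  have h := Real.add_one_le_exp (t ^ 2 / 2 - 1 / 2)
  have h2 : t ≤ Real.exp (t ^ 2 / 2 - 1 / 2) := by nlinarith [sq_nonneg (t - 1)]
  calc t * Real.exp (-(t ^ 2 / 2)) ≤ Real.exp (t ^ 2 / 2 - 1 / 2) * Real.exp (-(t ^ 2 / 2)) :=
        mul_le_mul_of_nonneg_right h2 (Real.exp_nonneg _)
    _ = _ := by rw [← Real.exp_add]; congr 1; ring

lemma exp_neg_half_le : Real.exp (-(1 / 2)) ≤ 0.242 * Real.sqrt (2 * Real.pi) := by
  apply le_of_sq_le_sq _ (by positivity)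
  rw [mul_pow, Real.sq_sqrt (by positivity), ← Real.exp_nat_mul]
  norm_num
  rw [Real.exp_neg, inv_eq_one_div, div_le_iff₀ (Real.exp_pos 1)]
  have h1 := Real.exp_one_gt_d9
  have h2 := Real.pi_gt_d4
  nlinarith

/-- With t = (b - l)/√b, Stirling bounds the left side by the Gaussian expression t e^{-t²/2}/√(2π).
Its maximum, at t = 1, is about 0.24197. -/
lemma sub_mul_poisWt_le {l : ℝ} (hl : 0 < l) (b : ℕ) : ((b : ℝ) - l) * poisWt l b ≤ 0.242 := by
  rcases le_or_gt (b : ℝ) l with hb | hb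
  · have := mul_nonpos_of_nonpos_of_nonneg (sub_nonpos.2 hb) (poisWt_nonneg hl.le b)
    linarith
  have hb0 : (0 : ℝ) < b := hl.trans hb
  have hbn : b ≠ 0 := by rintro rfl; simp at hb0
  have h := poisWt_le_stirling hl hbn
  set s := Real.sqrt b with hs
  have hs0 : 0 < s := Real.sqrt_pos.2 hb0
  have hss : s ^ 2 = b := Real.sq_sqrt hb0.le
  set u : ℝ := 1 - l / b with hu
  have hu1 : u < 1 := by rw [hu]; have : 0 < l / b := by positivity
                         linarith
  have hu0 : 0 ≤ u := by rw [hu]; have : l / b ≤ 1 := by rw [div_le_one hb0]; exact hb.le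
                         linarith
  have hlog := log_one_sub_le hu0 hu1
  have hbu : (b : ℝ) - l = b * u := by rw [hu]; field_simp
  have e1 : (b : ℝ) - l + b * Real.log (l / b) ≤ -((s * u) ^ 2 / 2) := by
    rw [show l / b = 1 - u by rw [hu]; ring, hbu, mul_pow, hss]
    nlinarith
  have h2 : poisWt l b ≤ Real.exp (-((s * u) ^ 2 / 2)) / (Real.sqrt (2 * Real.pi) * s) :=
    h.trans (div_le_div_of_nonneg_right (Real.exp_le_exp.2 e1) (by positivity))
  calc ((b : ℝ) - l) * poisWt l b
      ≤ (s ^ 2 * u) * (Real.exp (-((s * u) ^ 2 / 2)) / (Real.sqrt (2 * Real.pi) * s)) := by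
        rw [hbu, hss]
        exact mul_le_mul_of_nonneg_left h2 (by positivity)
    _ = ((s * u) * Real.exp (-((s * u) ^ 2 / 2))) / Real.sqrt (2 * Real.pi) := by
        field_simp
    _ ≤ Real.exp (-(1 / 2)) / Real.sqrt (2 * Real.pi) :=
        div_le_div_of_nonneg_right (mul_exp_neg_half_sq_le _) (by positivity)
    _ ≤ 0.242 := by
        rw [div_le_iff₀ (by positivity)]
        exact exp_neg_half_le

/-- The case a = 1 of `poisWt_sub_mul_le`. The maximum of (l - 1) l e^{-l} is about 0.3090, near l =
2.62; the small margin is why exp is expanded to third order at 2.6. -/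
lemma sub_one_mul_le {l : ℝ} (hl : 1 ≤ l) : (l - 1) * l ≤ 0.3097 * Real.exp l := by
  rcases le_total l 1.1 with h | h
  · have := Real.add_one_le_exp l
    nlinarith
  · have e : Real.exp l = Real.exp 1 ^ 2 * Real.exp 0.6 * Real.exp (l - 2.6) := by
      rw [← Real.exp_nat_mul, ← Real.exp_add, ← Real.exp_add]; congr 1; norm_num
    have h06 : (1.822 : ℝ) ≤ Real.exp 0.6 := by
      have := Real.sum_le_exp_of_nonneg (x := 0.6) (by norm_num) 6
      simp only [Finset.sum_range_succ, Finset.sum_range_zero, Nat.factorial] at this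
      norm_num at this ⊢
      linarith
    have h1 : (13.462 : ℝ) ≤ Real.exp 1 ^ 2 * Real.exp 0.6 := by
      have : (2.71828 : ℝ) ^ 2 ≤ Real.exp 1 ^ 2 :=
        pow_le_pow_left₀ (by norm_num) (by linarith [Real.exp_one_gt_d9]) _
      calc (13.462 : ℝ) ≤ 2.71828 ^ 2 * 1.822 := by norm_num
        _ ≤ _ := mul_le_mul this h06 (by norm_num) (by positivity)
    have h2 := cubic_le_exp (l - 2.6)
    rw [e]
    have h3 : (0.3097 * 13.462) * (1 + (l - 2.6) + (l - 2.6) ^ 2 / 2 + (l - 2.6) ^ 3 / 6) ≤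
        0.3097 * (Real.exp 1 ^ 2 * Real.exp 0.6 * Real.exp (l - 2.6)) := by
      rw [mul_assoc]
      apply mul_le_mul_of_nonneg_left _ (by norm_num)
      apply (mul_le_mul_of_nonneg_left h2 (by norm_num)).trans
      exact mul_le_mul_of_nonneg_right h1 (Real.exp_nonneg _)
    refine le_trans ?_ h3
    have hy : 0 ≤ (l - 2.6) + 1.5 := by linarith
    obtain ⟨y, rfl⟩ : ∃ y, l = y + 2.6 := ⟨l - 2.6, by ring⟩
    have hy' : 0 ≤ y + 1.5 := by linarith
    ring_nf
    nlinarith [mul_nonneg hy' (sq_nonneg y), sq_nonneg (y - 0.1)]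

/-- The case a = 2 of `poisWt_sub_mul_le`; the extremal point is l = 4. -/
lemma sub_two_mul_le {l : ℝ} (hl : 2 ≤ l) : (l - 2) * l ^ 2 / 2 ≤ 0.3097 * Real.exp l := by
  have he := Real.exp_one_gt_d9
  rcases le_total l 2.7 with h | h
  · have e : Real.exp l = Real.exp 1 ^ 2 * Real.exp (l - 2) := by
      rw [← Real.exp_nat_mul, ← Real.exp_add]; congr 1; norm_num
    have h1 : (7.38 : ℝ) ≤ Real.exp 1 ^ 2 := by nlinarith
    have h2 := Real.add_one_le_exp (l - 2)
    have h3 : 7.38 * (l - 2 + 1) ≤ Real.exp l := by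
      rw [e]; exact mul_le_mul h1 h2 (by linarith) (by positivity)
    nlinarith [mul_nonneg (sub_nonneg.2 hl) (sub_nonneg.2 h),
      mul_nonneg (mul_nonneg (sub_nonneg.2 hl) (sub_nonneg.2 h)) (by linarith : 0 ≤ l)]
  · have e : Real.exp l = Real.exp 1 ^ 4 * Real.exp (l - 4) := by
      rw [← Real.exp_nat_mul, ← Real.exp_add]; congr 1; norm_num
    have h1 : (54.598 : ℝ) ≤ Real.exp 1 ^ 4 := by
      calc (54.598 : ℝ) ≤ 2.7182818283 ^ 4 := by norm_num
        _ ≤ _ := pow_le_pow_left₀ (by norm_num) he.le _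
    have h2 := cubic_le_exp (l - 4)
    have h3 : 54.598 * (1 + (l - 4) + (l - 4) ^ 2 / 2 + (l - 4) ^ 3 / 6) ≤ Real.exp l := by
      rw [e]
      exact (mul_le_mul_of_nonneg_left h2 (by norm_num)).trans
        (mul_le_mul_of_nonneg_right h1 (Real.exp_nonneg _))
    obtain ⟨y, rfl⟩ : ∃ y, l = y + 4 := ⟨l - 4, by ring⟩
    have hy' : 0 ≤ y + 1.3 := by linarith
    ring_nf at h3 ⊢
    nlinarith [mul_nonneg hy' (sq_nonneg y), sq_nonneg (y + 1)]

lemma le_exp_rational {t : ℝ} (ht : 0 ≤ t) :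
    t ≤ 0.776 * Real.exp (3 * t ^ 2 / (6 + 2.31 * t)) := by
  set z := 3 * t ^ 2 / (6 + 2.31 * t) with hz
  have hz0 : 0 ≤ z := by positivity
  have h := Real.quadratic_le_exp_of_nonneg hz0
  suffices h2 : t ≤ 0.776 * (1 + z + z ^ 2 / 2) by linarith
  have e : 0.776 * (1 + z + z ^ 2 / 2) - t = (0.776 * ((6 + 2.31 * t) ^ 2 +
      3 * t ^ 2 * (6 + 2.31 * t) + 4.5 * t ^ 4) - t * (6 + 2.31 * t) ^ 2) / (6 + 2.31 * t) ^ 2 := by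
    rw [hz]; field_simp; ring
  have : 0 ≤ 0.776 * (1 + z + z ^ 2 / 2) - t := by
    rw [e]
    apply div_nonneg _ (by positivity)
    nlinarith [sq_nonneg (t ^ 2 - 1.4 * t), sq_nonneg (t - 1.4), mul_nonneg ht (sq_nonneg (t - 1.4)),
      sq_nonneg (t ^ 2 - 2), mul_nonneg ht (sq_nonneg (t - 1.5)), sq_nonneg (t ^ 2 - 0.1 * t - 1.8)]
  linarith

/-- For a ≥ 3, Stirling and `log_one_add_le` reduce the claim to `le_exp_rational` with t = (l -
a)/√a; there 2.31 is an upper bound for 4/√3. The value a = 0 must be excluded, since l e^{-l}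
reaches 1/e. -/
lemma poisWt_sub_mul_le {l : ℝ} (hl : 0 < l) {a : ℕ} (ha : a ≠ 0) :
    (l - a) * poisWt l a ≤ 0.3097 := by
  rcases le_or_gt l a with hb | hb
  · have := mul_nonpos_of_nonpos_of_nonneg (sub_nonpos.2 hb) (poisWt_nonneg hl.le a)
    linarith
  obtain rfl | rfl | ha3 : a = 1 ∨ a = 2 ∨ 3 ≤ a := by omega
  · have h := sub_one_mul_le (l := l) (by exact_mod_cast hb.le)
    simp only [poisWt, Real.exp_neg, Nat.factorial]
    norm_num
    rw [← mul_assoc, mul_comm _ (Real.exp l)⁻¹, mul_assoc, inv_mul_le_iff₀ (Real.exp_pos _)]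
    norm_num at h
    linarith
  · have h := sub_two_mul_le (l := l) (by exact_mod_cast hb.le)
    simp only [poisWt, Real.exp_neg, Nat.factorial]
    norm_num at h ⊢
    rw [show (l - 2) * ((Real.exp l)⁻¹ * l ^ 2 / 2) = (Real.exp l)⁻¹ * ((l - 2) * l ^ 2 / 2) by ring,
      inv_mul_le_iff₀ (Real.exp_pos _)]
    linarith
  have ha0 : (3 : ℝ) ≤ a := by exact_mod_cast ha3
  have hap : (0 : ℝ) < a := by linarith
  have h := poisWt_le_stirling hl ha
  set s := Real.sqrt a with hs
  have hs0 : 0 < s := Real.sqrt_pos.2 hap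
  have hss : s ^ 2 = a := Real.sq_sqrt hap.le
  have hs1 : 1.732 ≤ s := by apply Real.le_sqrt_of_sq_le; norm_num; linarith
  set t := (l - a) / s with ht
  have ht0 : 0 ≤ t := div_nonneg (by linarith) hs0.le
  have hla : l - a = t * s := by rw [ht]; field_simp
  have hu : 0 ≤ t / s := by positivity
  have hlog := log_one_add_le hu
  have e0 : l / a = 1 + t / s := by
    have : l = s ^ 2 + t * s := by linarith
    rw [← hss, this]; field_simp
  have e1 : (a : ℝ) - l + a * Real.log (l / a) ≤ -(3 * t ^ 2 / (6 + 2.31 * t)) := by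
    rw [e0]
    have h1 : (a : ℝ) * Real.log (1 + t / s) ≤ a * (t / s - 3 * (t / s) ^ 2 / (6 + 4 * (t / s))) :=
      mul_le_mul_of_nonneg_left hlog hap.le
    have h2 : (a : ℝ) * (t / s - 3 * (t / s) ^ 2 / (6 + 4 * (t / s))) =
        t * s - 3 * t ^ 2 / (6 + 4 * (t / s)) := by
      rw [← hss]; field_simp
    have h3 : 4 * (t / s) ≤ 2.31 * t := by
      rw [← mul_div_assoc, div_le_iff₀ hs0]; nlinarith
    have h4 : 3 * t ^ 2 / (6 + 2.31 * t) ≤ 3 * t ^ 2 / (6 + 4 * (t / s)) :=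
      div_le_div_of_nonneg_left (by positivity) (by positivity) (by linarith)
    linarith
  have h2 : poisWt l a ≤ Real.exp (-(3 * t ^ 2 / (6 + 2.31 * t))) / (Real.sqrt (2 * Real.pi) * s) :=
    h.trans (div_le_div_of_nonneg_right (Real.exp_le_exp.2 e1) (by positivity))
  have h3 := le_exp_rational ht0
  calc (l - a) * poisWt l a
      ≤ (t * s) * (Real.exp (-(3 * t ^ 2 / (6 + 2.31 * t))) / (Real.sqrt (2 * Real.pi) * s)) := by
        rw [hla]
        exact mul_le_mul_of_nonneg_left h2 (by positivity)
    _ = t * Real.exp (-(3 * t ^ 2 / (6 + 2.31 * t))) / Real.sqrt (2 * Real.pi) := by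
        field_simp
    _ ≤ 0.3097 := by
        rw [div_le_iff₀ (by positivity), Real.exp_neg, ← div_eq_mul_inv, div_le_iff₀ (Real.exp_pos _)]
        have := sqrt_two_pi_ge
        have h5 : (0.776 : ℝ) ≤ 0.3097 * Real.sqrt (2 * Real.pi) := by linarith
        exact h3.trans (mul_le_mul_of_nonneg_right h5 (Real.exp_nonneg _))

lemma sub_mul_poisWt_le_three {l : ℝ} (hl : 0 < l) (hl2 : l ≤ 2) {b : ℕ} (hb : 3 ≤ b) :
    ((b : ℝ) - l) * poisWt l b ≤ (3 - l) * poisWt l 3 := by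
  induction b, hb using Nat.le_induction with
  | base => norm_num
  | succ b hb ih =>
    refine le_trans ?_ ih
    rw [poisWt_succ]
    push_cast
    have hb' : (3 : ℝ) ≤ b := by exact_mod_cast hb
    have h : ((b : ℝ) + 1 - l) * (l / (b + 1)) ≤ b - l := by
      rw [← mul_div_assoc, div_le_iff₀ (by positivity)]
      nlinarith [mul_nonneg (sub_nonneg.2 hl2) (by linarith : (0 : ℝ) ≤ 2 * b - l)]
    have := mul_le_mul_of_nonneg_right h (poisWt_nonneg hl.le b)
    linarith

/-- Equality holds at l = 1, b = 2, so exp is expanded about 1. For l ≤ 2 the second term is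
nonincreasing in b from b = 3 on, which leaves b ≤ 3; for l ≥ 2 the two terms can be bounded
separately. -/
lemma poisWt_zero_add_le {l : ℝ} (hl : 0 < l) (b : ℕ) :
    l * poisWt l 0 + ((b : ℝ) - l) * poisWt l b ≤ 3 / (2 * Real.exp 1) := by
  have he := Real.exp_pos 1
  have hc := cubic_le_exp (l - 1)
  have key : ∀ q : ℝ, q ≤ 3 / 2 * Real.exp (l - 1) → q * Real.exp (-l) ≤ 3 / (2 * Real.exp 1) := by
    intro q hq
    have h := mul_le_mul_of_nonneg_right hq (Real.exp_nonneg (-l))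
    rw [mul_assoc, ← Real.exp_add, show l - 1 + -l = -1 by ring, Real.exp_neg 1] at h
    refine h.trans_eq ?_
    field_simp
  have h3 : l ≤ 2 → l * poisWt l 0 + (3 - l) * poisWt l 3 ≤ 3 / (2 * Real.exp 1) := by
    intro hl2
    have := key (l + (3 - l) * l ^ 3 / 6) (by
      refine le_trans ?_ (mul_le_mul_of_nonneg_left hc (by norm_num))
      nlinarith [sq_nonneg (l ^ 2 - 2 * l), sq_nonneg (l ^ 2 - 1.5 * l), sq_nonneg (l - 1.5),
        mul_nonneg hl.le (sq_nonneg (l - 1.5)), sq_nonneg (l ^ 2 - l - 1)])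
    simp only [poisWt, Nat.factorial]
    norm_num
    linarith
  obtain rfl | rfl | rfl | hb : b = 0 ∨ b = 1 ∨ b = 2 ∨ 3 ≤ b := by omega
  · have : 0 < 3 / (2 * Real.exp 1) := by positivity
    norm_num
    linarith
  · have := key (l + (1 - l) * l) (by
      nlinarith [sq_nonneg (l - 0.5), mul_nonneg hl.le (sq_nonneg (l - 0.5))])
    simp only [poisWt, Nat.factorial]
    norm_num
    linarith
  · have := key (l + (2 - l) * l ^ 2 / 2) (by
      nlinarith [mul_nonneg hl.le (sq_nonneg (l - 1)), sq_nonneg (l - 1)])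
    simp only [poisWt, Nat.factorial]
    norm_num
    linarith
  rcases le_total l 2 with hl2 | hl2
  · linarith [h3 hl2, sub_mul_poisWt_le_three hl hl2 hb]
  · have h1 := sub_mul_poisWt_le hl b
    have h2 : l * poisWt l 0 ≤ 0.29 := by
      rw [poisWt_zero, Real.exp_neg, ← div_eq_mul_inv, div_le_iff₀ (Real.exp_pos _)]
      have e : Real.exp l = Real.exp 1 ^ 2 * Real.exp (l - 2) := by
        rw [← Real.exp_nat_mul, ← Real.exp_add]; congr 1; norm_num
      have h1 : (7.38 : ℝ) ≤ Real.exp 1 ^ 2 := by nlinarith [Real.exp_one_gt_d9]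
      have h2 := Real.add_one_le_exp (l - 2)
      have h3 : 7.38 * (l - 2 + 1) ≤ Real.exp l := by
        rw [e]; exact mul_le_mul h1 h2 (by linarith) (by positivity)
      nlinarith
    have h3 : (0.55 : ℝ) ≤ 3 / (2 * Real.exp 1) := by
      rw [le_div_iff₀ (by positivity)]; nlinarith [Real.exp_one_lt_d9]
    linarith

/-- With suitable a and b, the left side is l/2 times the ℓ¹ norm of the second difference of the
Poisson weights. For a ≥ 1 the separate bounds add up to 0.5517, just below 3/(2e) ≈ 0.5518. -/
lemma poisWt_extremes_le {l : ℝ} (hl : 0 < l) (a b : ℕ) :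
    (l - a) * poisWt l a + ((b : ℝ) - l) * poisWt l b ≤ 3 / (2 * Real.exp 1) := by
  rcases eq_or_ne a 0 with rfl | ha
  · simpa using poisWt_zero_add_le hl b
  · have h1 := poisWt_sub_mul_le hl ha
    have h2 := sub_mul_poisWt_le hl b
    have h3 : (0.5517 : ℝ) ≤ 3 / (2 * Real.exp 1) := by
      rw [le_div_iff₀ (by positivity)]; nlinarith [Real.exp_one_lt_d9]
    linarith

/-! ### Charlier polynomials: orthogonality and ℓ¹ norms. -/

/-- The Charlier polynomials, normalised so that `poisWt l k * charlier l j k` is the `j`-th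
backward difference of the Poisson weights. -/
noncomputable def charlier (l : ℝ) : ℕ → ℕ → ℝ
  | 0, _ => 1
  -- At k = 0 the truncated k - 1 is harmless, as its factor k / l vanishes.
  | j + 1, k => k / l * charlier l j (k - 1) - charlier l j k

lemma charlier_zero (l : ℝ) (k : ℕ) : charlier l 0 k = 1 := rfl

lemma charlier_succ (l : ℝ) (j k : ℕ) :
    charlier l (j + 1) k = k / l * charlier l j (k - 1) - charlier l j k := rfl

/-- Forward differencing lowers the degree. Under the Poisson law it is adjoint to the raising
operation that defines the polynomials, and this yields orthogonality by summation by parts. -/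
lemma charlier_succ_sub (l : ℝ) (j k : ℕ) :
    charlier l (j + 1) (k + 1) - charlier l (j + 1) k = (j + 1) / l * charlier l j k := by
  induction j generalizing k with
  | zero =>
    simp only [charlier_succ, charlier_zero]
    push_cast
    ring
  | succ j ih =>
    rw [charlier_succ l (j + 1) (k + 1), charlier_succ l (j + 1) k, Nat.add_sub_cancel]
    have h1 := ih k
    rcases k with _ | k
    · have h2 := charlier_succ l j 0
      push_cast at h1 h2 ⊢
      simp only [zero_div, zero_mul, zero_sub] at h2 ⊢
      linear_combination -h1 - (j + 1) / l * h2
    · have h2 := ih k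
      have h3 := charlier_succ l j (k + 1)
      rw [Nat.add_sub_cancel] at h3 ⊢
      push_cast at h1 h2 h3 ⊢
      linear_combination (k + 1) / l * h2 - h1 - (j + 1) / l * h3

lemma abs_charlier_le {l : ℝ} (hl : 0 < l) (j k : ℕ) : |charlier l j k| ≤ (1 + k / l) ^ j := by
  induction j generalizing k with
  | zero => simp [charlier_zero]
  | succ j ih =>
    have h1 : |charlier l j (k - 1)| ≤ (1 + k / l) ^ j := by
      refine (ih (k - 1)).trans (pow_le_pow_left₀ (by positivity) ?_ _)
      gcongr
      exact Nat.sub_le _ _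
    have h2 : (0 : ℝ) ≤ k / l := by positivity
    calc |charlier l (j + 1) k| ≤ |k / l * charlier l j (k - 1)| + |charlier l j k| := abs_sub _ _
      _ ≤ k / l * (1 + k / l) ^ j + (1 + k / l) ^ j := by
          rw [abs_mul, abs_of_nonneg h2]
          exact add_le_add (mul_le_mul_of_nonneg_left h1 h2) (ih k)
      _ = _ := by ring

lemma summable_poisWt_mul_pow {l : ℝ} (hl : 0 < l) (m : ℕ) :
    Summable fun k : ℕ => poisWt l k * (1 + k / l) ^ m := by
  have h1 : Summable fun k : ℕ => (m.factorial * Real.exp 1 * Real.exp (-l)) *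
      ((l * Real.exp (1 / l)) ^ k / (k.factorial : ℝ)) :=
    (hasSum_pow_div_factorial _).summable.mul_left _
  refine h1.of_nonneg_of_le (fun k => mul_nonneg (poisWt_nonneg hl.le k) (by positivity)) fun k => ?_
  have h2 := Real.pow_div_factorial_le_exp (x := 1 + k / l) (by positivity) m
  rw [div_le_iff₀ (by positivity)] at h2
  have h3 : Real.exp (1 + k / l) = Real.exp 1 * Real.exp (1 / l) ^ k := by
    rw [← Real.exp_nat_mul, ← Real.exp_add]; congr 1; ring
  calc poisWt l k * (1 + k / l) ^ m ≤ poisWt l k * (Real.exp (1 + k / l) * m.factorial) :=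
        mul_le_mul_of_nonneg_left h2 (poisWt_nonneg hl.le k)
    _ = _ := by rw [h3, poisWt, mul_pow]; ring

lemma summable_poisWt_mul_of_le {l : ℝ} (hl : 0 < l) {f : ℕ → ℝ} (m : ℕ)
    (hf : ∀ k, |f k| ≤ (1 + k / l) ^ m) : Summable fun k => poisWt l k * f k := by
  refine (summable_poisWt_mul_pow hl m).of_norm_bounded fun k => ?_
  rw [Real.norm_eq_abs, abs_mul, abs_of_nonneg (poisWt_nonneg hl.le k)]
  exact mul_le_mul_of_nonneg_left (hf k) (poisWt_nonneg hl.le k)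

lemma summable_charlier_mul {l : ℝ} (hl : 0 < l) (i j : ℕ) :
    Summable fun k => poisWt l k * (charlier l i k * charlier l j k) := by
  refine summable_poisWt_mul_of_le hl (i + j) fun k => ?_
  rw [abs_mul, pow_add]
  exact mul_le_mul (abs_charlier_le hl i k) (abs_charlier_le hl j k) (abs_nonneg _) (by positivity)

/-- The inner product of two Charlier polynomials with respect to the Poisson law. -/
noncomputable def charlierInner (l : ℝ) (i j : ℕ) : ℝ :=
  ∑' k, poisWt l k * (charlier l i k * charlier l j k)

lemma charlierInner_comm (l : ℝ) (i j : ℕ) : charlierInner l i j = charlierInner l j i := by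
  unfold charlierInner
  congr 1; ext k; ring

lemma charlierInner_succ_zero {l : ℝ} (hl : 0 < l) (i : ℕ) : charlierInner l (i + 1) 0 = 0 := by
  have h1 := summable_charlier_mul hl (i + 1) 0
  have h0 := summable_charlier_mul hl i 0
  have h2 : Summable fun k => poisWt l k * (k / l * charlier l i (k - 1)) := by
    refine (h1.add h0).congr fun k => ?_
    simp only [charlier_succ, charlier_zero]
    ring
  have h3 : ∑' k, poisWt l k * (k / l * charlier l i (k - 1)) =
      ∑' k, poisWt l k * (charlier l i k * charlier l 0 k) := by
    rw [h2.tsum_eq_zero_add]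
    simp only [Nat.cast_zero, zero_div, zero_mul, mul_zero, zero_add, Nat.add_sub_cancel,
      charlier_zero, mul_one]
    congr 1; ext k
    have := succ_mul_poisWt_succ l k
    push_cast
    field_simp
    linear_combination charlier l i k * this
  unfold charlierInner
  calc ∑' k, poisWt l k * (charlier l (i + 1) k * charlier l 0 k)
      = ∑' k, (poisWt l k * (k / l * charlier l i (k - 1)) -
          poisWt l k * (charlier l i k * charlier l 0 k)) := by
        congr 1; ext k; simp only [charlier_succ, charlier_zero]; ring
    _ = 0 := by rw [h2.tsum_sub h0, h3, sub_self]

lemma charlierInner_succ_succ {l : ℝ} (hl : 0 < l) (i j : ℕ) :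
    charlierInner l (i + 1) (j + 1) = (j + 1) / l * charlierInner l i j := by
  have h1 := summable_charlier_mul hl (i + 1) (j + 1)
  have h0 := summable_charlier_mul hl i (j + 1)
  have h4 := (summable_charlier_mul hl i j).mul_left ((j + 1) / l)
  have h2 : Summable fun k => poisWt l k * (k / l * charlier l i (k - 1) * charlier l (j + 1) k) := by
    refine (h1.add h0).congr fun k => ?_
    rw [charlier_succ l i]
    ring
  have h3 : ∑' k, poisWt l k * (k / l * charlier l i (k - 1) * charlier l (j + 1) k) =
      ∑' k, (poisWt l k * (charlier l i k * charlier l (j + 1) k) +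
        (j + 1) / l * (poisWt l k * (charlier l i k * charlier l j k))) := by
    rw [h2.tsum_eq_zero_add]
    simp only [Nat.cast_zero, zero_div, zero_mul, mul_zero, zero_add, Nat.add_sub_cancel]
    congr 1; ext k
    have h5 := succ_mul_poisWt_succ l k
    have h6 := charlier_succ_sub l j k
    have h7 : poisWt l (k + 1) * (((k + 1 : ℕ) : ℝ) / l) = poisWt l k := by
      push_cast; field_simp; linarith
    linear_combination charlier l i k * charlier l (j + 1) (k + 1) * h7 +
      poisWt l k * charlier l i k * h6
  unfold charlierInner
  calc ∑' k, poisWt l k * (charlier l (i + 1) k * charlier l (j + 1) k)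
      = ∑' k, (poisWt l k * (k / l * charlier l i (k - 1) * charlier l (j + 1) k) -
          poisWt l k * (charlier l i k * charlier l (j + 1) k)) := by
        congr 1; ext k; rw [charlier_succ l i]; ring
    _ = _ := by rw [h2.tsum_sub h0, h3, h0.tsum_add h4, tsum_mul_left]; ring

lemma charlierInner_eq {l : ℝ} (hl : 0 < l) (i j : ℕ) :
    charlierInner l i j = if i = j then (j.factorial : ℝ) / l ^ j else 0 := by
  induction i generalizing j with
  | zero =>
    rcases j with _ | j
    · simp [charlierInner, charlier_zero, tsum_poisWt]
    · rw [charlierInner_comm, charlierInner_succ_zero hl]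
      simp
  | succ i ih =>
    rcases j with _ | j
    · rw [charlierInner_succ_zero hl]
      simp
    · rw [charlierInner_succ_succ hl, ih]
      simp only [Nat.add_right_cancel_iff]
      split_ifs
      · rw [Nat.factorial_succ, pow_succ]
        push_cast
        field_simp
      · simp

/-- Cauchy–Schwarz against the Poisson probability law, then orthogonality: the square norm of the
j-th polynomial is j!/l^j. -/
lemma sum_abs_charlier_le {l : ℝ} (hl : 0 < l) (c : ℕ → ℝ) (J : Finset ℕ) (K : Finset ℕ) :
    ∑ k ∈ K, |∑ j ∈ J, c j * (poisWt l k * charlier l j k)| ≤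
      Real.sqrt (∑ j ∈ J, c j ^ 2 * (j.factorial / l ^ j)) := by
  apply Real.le_sqrt_of_sq_le
  set S : ℕ → ℝ := fun k => ∑ j ∈ J, c j * charlier l j k with hS
  have e1 : ∀ k, |∑ j ∈ J, c j * (poisWt l k * charlier l j k)| = poisWt l k * |S k| := by
    intro k
    rw [← abs_of_nonneg (poisWt_nonneg hl.le k), ← abs_mul, abs_of_nonneg (poisWt_nonneg hl.le k),
      hS, Finset.mul_sum]
    congr 1
    exact Finset.sum_congr rfl fun j _ => by ring
  simp only [e1]
  have hsum : HasSum (fun k => poisWt l k * S k ^ 2) (∑ j ∈ J, c j ^ 2 * (j.factorial / l ^ j)) := by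
    have h : HasSum (fun k => ∑ i ∈ J, ∑ j ∈ J, c i * c j *
        (poisWt l k * (charlier l i k * charlier l j k)))
        (∑ i ∈ J, ∑ j ∈ J, c i * c j * charlierInner l i j) :=
      hasSum_sum fun i _ => hasSum_sum fun j _ => (summable_charlier_mul hl i j).hasSum.mul_left _
    have e2 : ∑ i ∈ J, ∑ j ∈ J, c i * c j * charlierInner l i j =
        ∑ j ∈ J, c j ^ 2 * (j.factorial / l ^ j) := by
      refine Finset.sum_congr rfl fun i hi => ?_
      simp only [charlierInner_eq hl, mul_ite, mul_zero]
      rw [Finset.sum_ite_eq, if_pos hi, sq]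
    rw [e2] at h
    refine h.congr_fun fun k => ?_
    simp only [hS]
    rw [sq, Finset.sum_mul_sum, Finset.mul_sum]
    refine Finset.sum_congr rfl fun i _ => ?_
    rw [Finset.mul_sum]
    exact Finset.sum_congr rfl fun j _ => by ring
  calc (∑ k ∈ K, poisWt l k * |S k|) ^ 2
      = (∑ k ∈ K, Real.sqrt (poisWt l k) * (Real.sqrt (poisWt l k) * |S k|)) ^ 2 := by
        congr 1
        refine Finset.sum_congr rfl fun k _ => ?_
        rw [← mul_assoc, Real.mul_self_sqrt (poisWt_nonneg hl.le k)]
    _ ≤ (∑ k ∈ K, Real.sqrt (poisWt l k) ^ 2) * ∑ k ∈ K, (Real.sqrt (poisWt l k) * |S k|) ^ 2 :=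
        Finset.sum_mul_sq_le_sq_mul_sq _ _ _
    _ = (∑ k ∈ K, poisWt l k) * ∑ k ∈ K, poisWt l k * S k ^ 2 := by
        congr 1
        · exact Finset.sum_congr rfl fun k _ => Real.sq_sqrt (poisWt_nonneg hl.le k)
        · exact Finset.sum_congr rfl fun k _ => by
            rw [mul_pow, Real.sq_sqrt (poisWt_nonneg hl.le k), sq_abs]
    _ ≤ 1 * ∑ j ∈ J, c j ^ 2 * (j.factorial / l ^ j) := by
        apply mul_le_mul
        · exact sum_le_hasSum _ (fun k _ => poisWt_nonneg hl.le k) (hasSum_poisWt l)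
        · exact sum_le_hasSum _ (fun k _ => mul_nonneg (poisWt_nonneg hl.le k) (sq_nonneg _)) hsum
        · exact Finset.sum_nonneg fun k _ => mul_nonneg (poisWt_nonneg hl.le k) (sq_nonneg _)
        · norm_num
    _ = _ := one_mul _

lemma charlier_two {l : ℝ} (hl : l ≠ 0) (k : ℕ) :
    charlier l 2 k = ((k : ℝ) ^ 2 - (2 * l + 1) * k + l ^ 2) / l ^ 2 := by
  rcases k with _ | k
  · simp [charlier_succ, charlier_zero]; field_simp
  · simp only [charlier_succ, charlier_zero, Nat.add_sub_cancel]
    push_cast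
    field_simp
    ring

lemma poisWt_mul_charlier_succ {l : ℝ} (hl : l ≠ 0) (j k : ℕ) :
    poisWt l (k + 1) * charlier l (j + 1) (k + 1) =
      poisWt l k * charlier l j k - poisWt l (k + 1) * charlier l j (k + 1) := by
  rw [charlier_succ, Nat.add_sub_cancel]
  have h7 : poisWt l (k + 1) * (((k + 1 : ℕ) : ℝ) / l) = poisWt l k := by
    have h5 := succ_mul_poisWt_succ l k
    push_cast; field_simp; linarith
  linear_combination charlier l j k * h7

lemma poisWt_mul_charlier_one {l : ℝ} (hl : l ≠ 0) (k : ℕ) :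
    poisWt l k * charlier l 1 k = ((k : ℝ) - l) * poisWt l k / l := by
  simp only [charlier_succ, charlier_zero]
  field_simp

lemma sum_range_poisWt_mul_charlier_two {l : ℝ} (hl : l ≠ 0) (m : ℕ) :
    ∑ k ∈ Finset.range (m + 1), poisWt l k * charlier l 2 k = (l - m) * poisWt l m / l := by
  induction m with
  | zero => simp [charlier_succ, charlier_zero]; field_simp
  | succ m ih =>
    rw [Finset.sum_range_succ, ih, poisWt_mul_charlier_succ hl, poisWt_mul_charlier_one hl,
      poisWt_mul_charlier_one hl]
    ring

lemma hasSum_poisWt_mul_charlier_two {l : ℝ} (hl : 0 < l) :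
    HasSum (fun k => poisWt l k * charlier l 2 k) 0 := by
  have h := (summable_charlier_mul hl 2 0).hasSum
  change HasSum _ (charlierInner l 2 0) at h
  rw [charlierInner_succ_zero hl] at h
  simpa [charlier_zero] using h

/-- The second polynomial is a convex quadratic, so it is negative on an interval of integers [a,
b], over which the second differences telescope to boundary terms at a - 1 and b. Here a ≥ 1 because
its value at 0 is 1. -/
lemma neg_sum_charlier_two_le {l : ℝ} (hl : 0 < l) (N : Finset ℕ)
    (hN : ∀ k, k ∈ N ↔ charlier l 2 k < 0) :
    -∑ k ∈ N, poisWt l k * charlier l 2 k ≤ 3 / (2 * Real.exp 1) / l := by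
  rcases N.eq_empty_or_nonempty with rfl | hne
  · simp; positivity
  have hcx : ∀ a b c : ℕ, a ≤ b → b ≤ c → a ∈ N → c ∈ N → b ∈ N := by
    intro a b c hab hbc ha hc
    rw [hN, charlier_two hl.ne', div_neg_iff] at ha hc ⊢
    have hl2 : 0 < l ^ 2 := by positivity
    replace ha : (a : ℝ) ^ 2 - (2 * l + 1) * a + l ^ 2 < 0 := by
      rcases ha with h | h
      · linarith [h.2]
      · exact h.1
    replace hc : (c : ℝ) ^ 2 - (2 * l + 1) * c + l ^ 2 < 0 := by
      rcases hc with h | h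
      · linarith [h.2]
      · exact h.1
    refine Or.inr ⟨?_, hl2⟩
    have hab' : (a : ℝ) ≤ b := by exact_mod_cast hab
    have hbc' : (b : ℝ) ≤ c := by exact_mod_cast hbc
    by_contra! hb
    rcases le_total (2 * (b : ℝ)) (2 * l + 1) with h | h
    · nlinarith
    · nlinarith
  set a := N.min' hne with ha
  set b := N.max' hne with hb
  have hab : a ≤ b := N.min'_le _ (N.max'_mem hne)
  have hIcc : N = Finset.Icc a b := by
    ext k
    rw [Finset.mem_Icc]
    exact ⟨fun h => ⟨N.min'_le _ h, N.le_max' _ h⟩,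
      fun h => hcx a k b h.1 h.2 (N.min'_mem hne) (N.max'_mem hne)⟩
  have ha0 : a ≠ 0 := by
    intro h0
    have h1 : a ∈ N := N.min'_mem hne
    rw [hN, h0, charlier_two hl.ne'] at h1
    have : 0 < l ^ 2 / l ^ 2 := by positivity
    norm_num at h1
    linarith
  obtain ⟨a', ha'⟩ := Nat.exists_eq_succ_of_ne_zero ha0
  have hs : ∑ k ∈ N, poisWt l k * charlier l 2 k =
      (l - b) * poisWt l b / l - (l - a') * poisWt l a' / l := by
    rw [← sum_range_poisWt_mul_charlier_two hl.ne', ← sum_range_poisWt_mul_charlier_two hl.ne',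
      hIcc, ha', ← Finset.sum_Ico_eq_sub _ (by omega)]
    rfl
  rw [hs, le_div_iff₀ hl]
  have := poisWt_extremes_le hl a' b
  calc -((l - b) * poisWt l b / l - (l - a') * poisWt l a' / l) * l
      = (l - a') * poisWt l a' + (b - l) * poisWt l b := by field_simp; ring
    _ ≤ _ := this

/-- The second differences sum to zero, so their ℓ¹ norm is twice the negative part. -/
lemma sum_abs_charlier_two_le {l : ℝ} (hl : 0 < l) (K : Finset ℕ) :
    ∑ k ∈ K, |poisWt l k * charlier l 2 k| ≤ 3 / Real.exp 1 / l := by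
  classical
  have hfin : {k : ℕ | charlier l 2 k < 0}.Finite := by
    refine (Set.finite_Iic ⌈2 * l + 1⌉₊).subset fun k hk => ?_
    rw [Set.mem_ofPred_eq, charlier_two hl.ne', div_lt_iff₀ (by positivity), zero_mul] at hk
    rw [Set.mem_Iic]
    by_contra! h
    have h1 : 2 * l + 1 < k := (Nat.le_ceil _).trans_lt (by exact_mod_cast h)
    nlinarith
  set N := hfin.toFinset with hNdef
  have hN : ∀ k, k ∈ N ↔ charlier l 2 k < 0 := fun k => by simp [hNdef]
  have hneg := neg_sum_charlier_two_le hl N hN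
  set f := fun k => poisWt l k * charlier l 2 k with hf
  have hpos : ∑ k ∈ K, |f k| ≤ ∑ k ∈ K ∪ N, |f k| :=
    Finset.sum_le_sum_of_subset_of_nonneg Finset.subset_union_left fun _ _ _ => abs_nonneg _
  have hnonneg : ∀ k, k ∉ N → 0 ≤ f k := fun k hk =>
    mul_nonneg (poisWt_nonneg hl.le k) (not_lt.1 fun h => hk ((hN k).2 h))
  have h0 : ∑ k ∈ K ∪ N, f k ≤ 0 := by
    refine sum_le_hasSum _ (fun k hk => hnonneg k fun h => hk (Finset.mem_union_right _ h))
      (hasSum_poisWt_mul_charlier_two hl)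
  have e : ∑ k ∈ K ∪ N, |f k| = ∑ k ∈ K ∪ N, f k - 2 * ∑ k ∈ N, f k := by
    have h1 : ∑ k ∈ N, f k = ∑ k ∈ K ∪ N, if k ∈ N then f k else 0 := by
      rw [← Finset.sum_filter]
      congr 1
      ext k; simp
    rw [h1, Finset.mul_sum, ← Finset.sum_sub_distrib]
    refine Finset.sum_congr rfl fun k _ => ?_
    split_ifs with h
    · rw [abs_of_nonpos (mul_nonpos_of_nonneg_of_nonpos (poisWt_nonneg hl.le k)
        ((hN k).1 h).le)]
      ring
    · rw [abs_of_nonneg (hnonneg k h)]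
      ring
  have e2 : 3 / Real.exp 1 / l = 2 * (3 / (2 * Real.exp 1) / l) := by ring
  linarith

/-! ### Expansion of the Bernoulli-sum law in differences of the Poisson law. -/

section Expansion

open PowerSeries

/-- The exponential series `exp (c X)`. -/
noncomputable def expSer (c : ℝ) : PowerSeries ℝ := PowerSeries.mk fun m => c ^ m / (m.factorial : ℝ)

lemma coeff_expSer (c : ℝ) (m : ℕ) : coeff m (expSer c) = c ^ m / (m.factorial : ℝ) := by
  simp [expSer]

lemma expSer_eq (c : ℝ) : expSer c = rescale c (PowerSeries.exp ℝ) := by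
  ext m
  simp [coeff_expSer, PowerSeries.coeff_exp, div_eq_mul_inv]

lemma expSer_mul (c d : ℝ) : expSer c * expSer d = expSer (c + d) := by
  simp only [expSer_eq, PowerSeries.exp_mul_exp_eq_exp_add]

lemma expSer_zero : expSer 0 = 1 := by
  ext m
  rw [coeff_expSer, coeff_one]
  rcases m with _ | m <;> simp

/-- The power series with the Poisson weights as coefficients. -/
noncomputable def poisSer (l : ℝ) : PowerSeries ℝ := PowerSeries.mk (poisWt l)

lemma poisSer_eq (l : ℝ) : poisSer l = C (Real.exp (-l)) * expSer l := by
  ext k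
  simp [poisSer, coeff_expSer, coeff_C_mul, poisWt, mul_div_assoc]

lemma coeff_X_sub_one_mul_succ (F : PowerSeries ℝ) (k : ℕ) :
    coeff (k + 1) ((X - 1) * F) = coeff k F - coeff (k + 1) F := by
  rw [sub_mul, one_mul, map_sub, coeff_succ_X_mul]

lemma coeff_X_sub_one_mul_zero (F : PowerSeries ℝ) :
    coeff 0 ((X - 1) * F) = -coeff 0 F := by
  rw [sub_mul, one_mul, map_sub, coeff_zero_X_mul, zero_sub]

lemma coeff_X_sub_one_pow_mul_poisSer {l : ℝ} (hl : l ≠ 0) (j k : ℕ) :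
    coeff k ((X - 1) ^ j * poisSer l) = poisWt l k * charlier l j k := by
  induction j generalizing k with
  | zero => simp [poisSer, charlier_zero]
  | succ j ih =>
    rw [pow_succ', mul_assoc]
    rcases k with _ | k
    · rw [coeff_X_sub_one_mul_zero, ih, charlier_succ]
      simp
    · rw [coeff_X_sub_one_mul_succ, ih, ih, poisWt_mul_charlier_succ hl]

lemma coeff_X_sub_one_pow (i j : ℕ) :
    coeff i ((X - 1 : PowerSeries ℝ) ^ (j + i)) = (-1) ^ j * ((j + i).choose i : ℝ) := by
  have h := Polynomial.coeff_X_add_C_pow (-1 : ℝ) (j + i) i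
  rw [← Polynomial.coeff_coe, Nat.add_sub_cancel] at h
  simpa [sub_eq_add_neg] using h

lemma coeff_X_sub_one_pow_of_lt {i j : ℕ} (h : j < i) :
    coeff i ((X - 1 : PowerSeries ℝ) ^ j) = 0 := by
  have h2 := Polynomial.coeff_X_add_C_pow (-1 : ℝ) j i
  rw [← Polynomial.coeff_coe, Nat.choose_eq_zero_of_lt h] at h2
  simpa [sub_eq_add_neg] using h2

/-- This is e^{-lY} expanded in powers of Y = X - 1. As Y has a nonzero constant term it cannot be
substituted formally, so each coefficient is a convergent real series. -/
lemma hasSum_coeff_X_sub_one_pow (l : ℝ) (i : ℕ) :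
    HasSum (fun j => coeff j (expSer (-l)) * coeff i ((X - 1 : PowerSeries ℝ) ^ j))
      (coeff i (C (Real.exp l) * expSer (-l))) := by
  rw [← hasSum_nat_add_iff' i]
  have h0 : ∑ j ∈ Finset.range i, coeff j (expSer (-l)) * coeff i ((X - 1 : PowerSeries ℝ) ^ j) = 0 :=
    Finset.sum_eq_zero fun j hj => by
      rw [coeff_X_sub_one_pow_of_lt (Finset.mem_range.1 hj), mul_zero]
  rw [h0, sub_zero, coeff_C_mul, coeff_expSer, mul_comm]
  refine ((hasSum_pow_div_factorial l).mul_left ((-l) ^ i / (i.factorial : ℝ))).congr_fun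
    fun j => ?_
  rw [coeff_X_sub_one_pow, coeff_expSer, Nat.cast_choose ℝ (Nat.le_add_left i j),
    Nat.add_sub_cancel, pow_add, neg_pow l j]
  have : ((-1 : ℝ) ^ j) * (-1) ^ j = 1 := by rw [← mul_pow]; simp
  field_simp
  linear_combination l ^ j * (-l) ^ i * this

/-- The identity e^{-lY} e^{lY} = 1 with Y = X - 1: the base case, to which the factors 1 + p_i Y
are then attached one by one. -/
lemma hasSum_expSer_poisSer (l : ℝ) (k : ℕ) :
    HasSum (fun j => coeff j (expSer (-l)) * coeff k ((X - 1) ^ j * poisSer l))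
      (coeff k (1 : PowerSeries ℝ)) := by
  have h : HasSum (fun j => ∑ q ∈ Finset.HasAntidiagonal.antidiagonal k,
      coeff j (expSer (-l)) * coeff q.1 ((X - 1 : PowerSeries ℝ) ^ j) * coeff q.2 (poisSer l))
      (∑ q ∈ Finset.HasAntidiagonal.antidiagonal k, coeff q.1 (C (Real.exp l) * expSer (-l)) *
        coeff q.2 (poisSer l)) :=
    hasSum_sum fun q _ => (hasSum_coeff_X_sub_one_pow l q.1).mul_right _
  rw [← coeff_mul, poisSer_eq, mul_mul_mul_comm, expSer_mul, neg_add_cancel, expSer_zero, mul_one,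
    ← map_mul, ← Real.exp_add, add_neg_cancel, Real.exp_zero, map_one] at h
  refine h.congr_fun fun j => ?_
  rw [coeff_mul, Finset.mul_sum, poisSer_eq]
  exact Finset.sum_congr rfl fun q _ => by ring

/-- If `G` is the coefficientwise sum of `∑ a_j (X - 1)^j E`, then multiplying the coefficient
series by `1 + p X` multiplies `G` by `1 + p (X - 1)`. -/
lemma hasSum_one_add_mul {A G E : PowerSeries ℝ} (p : ℝ)
    (h : ∀ k, HasSum (fun j => coeff j A * coeff k ((X - 1) ^ j * E)) (coeff k G)) (k : ℕ) :
    HasSum (fun j => coeff j ((1 + C p * X) * A) * coeff k ((X - 1) ^ j * E))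
      (coeff k ((1 + C p * (X - 1)) * G)) := by
  have h1 : ∀ k, HasSum (fun j => coeff j A * coeff k ((X - 1) ^ (j + 1) * E))
      (coeff k ((X - 1) * G)) := by
    intro k
    simp only [pow_succ', mul_assoc]
    rcases k with _ | k
    · simp only [coeff_X_sub_one_mul_zero]
      refine (h 0).neg.congr_fun fun j => by ring
    · simp only [coeff_X_sub_one_mul_succ]
      refine ((h k).sub (h (k + 1))).congr_fun fun j => by ring
  have h2 : HasSum (fun j => coeff j (X * A) * coeff k ((X - 1) ^ j * E))
      (coeff k ((X - 1) * G)) := by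
    rw [← hasSum_nat_add_iff' 1]
    simpa [coeff_succ_X_mul] using h1 k
  have h3 := (h k).add (h2.mul_left p)
  rw [add_mul 1 (C p * (X - 1)), one_mul, mul_assoc (C p) (X - 1), map_add, coeff_C_mul]
  refine h3.congr_fun fun j => ?_
  rw [add_mul, one_mul, mul_assoc, map_add, coeff_C_mul]
  ring

variable {I : Type*}

/-- The coefficients of the expansion of the law of a Bernoulli sum in Charlier polynomials. -/
noncomputable def charlierSer (s : Finset I) (p : I → ℝ) : PowerSeries ℝ :=
  (∏ i ∈ s, (1 + C (p i) * X)) * expSer (-∑ i ∈ s, p i)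

/-- The probability generating function of a sum of independent Bernoulli variables. -/
noncomputable def bernSer (s : Finset I) (p : I → ℝ) : PowerSeries ℝ :=
  ∏ i ∈ s, (1 + C (p i) * (X - 1))

lemma hasSum_charlierSer (s : Finset I) (p : I → ℝ) (hl : ∑ i ∈ s, p i ≠ 0) (k : ℕ) :
    HasSum (fun j => coeff j (charlierSer s p) *
      (poisWt (∑ i ∈ s, p i) k * charlier (∑ i ∈ s, p i) j k)) (coeff k (bernSer s p)) := by
  classical
  set l := ∑ i ∈ s, p i with hldef
  -- The Poisson mean stays that of the full set s while the factors are added.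
  have key : ∀ t : Finset I, ∀ k, HasSum (fun j =>
      coeff j ((∏ i ∈ t, (1 + C (p i) * X)) * expSer (-l)) * coeff k ((X - 1) ^ j * poisSer l))
      (coeff k (∏ i ∈ t, (1 + C (p i) * (X - 1)))) := by
    intro t
    induction t using Finset.induction_on with
    | empty =>
      intro k
      simpa using hasSum_expSer_poisSer l k
    | insert a t ha ih =>
      intro k
      rw [Finset.prod_insert ha, Finset.prod_insert ha, mul_assoc]
      exact hasSum_one_add_mul (p a) ih k
  have := key s k
  simpa only [coeff_X_sub_one_pow_mul_poisSer hl, charlierSer, bernSer] using this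

lemma charlierSer_insert [DecidableEq I] {s : Finset I} (p : I → ℝ) {a : I} (ha : a ∉ s) :
    charlierSer (insert a s) p = ((1 + C (p a) * X) * expSer (-p a)) * charlierSer s p := by
  unfold charlierSer
  rw [Finset.prod_insert ha, Finset.sum_insert ha, neg_add, ← expSer_mul]
  ring

/-- Matching the means removes the linear term of each factor, so in the product the coefficients of
orders 2 and 3 simply add up. -/
lemma coeff_charlier_factor (p : ℝ) :
    coeff 0 ((1 + C p * X) * expSer (-p)) = 1 ∧ coeff 1 ((1 + C p * X) * expSer (-p)) = 0 ∧
    coeff 2 ((1 + C p * X) * expSer (-p)) = -(p ^ 2 / 2) ∧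
    coeff 3 ((1 + C p * X) * expSer (-p)) = p ^ 3 / 3 := by
  have h : ∀ m, coeff (m + 1) ((1 + C p * X) * expSer (-p)) =
      coeff (m + 1) (expSer (-p)) + p * coeff m (expSer (-p)) := by
    intro m
    rw [add_mul, one_mul, mul_assoc, map_add, coeff_C_mul, coeff_succ_X_mul]
  refine ⟨?_, ?_, ?_, ?_⟩
  · rw [add_mul, one_mul, mul_assoc, map_add, coeff_C_mul, coeff_zero_X_mul, coeff_expSer]
    simp
  · rw [h 0]; simp [coeff_expSer]
  · rw [h 1]; simp [coeff_expSer, Nat.factorial]; ring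
  · rw [h 2]; simp [coeff_expSer, Nat.factorial]; ring

lemma coeff_charlierSer (s : Finset I) (p : I → ℝ) :
    coeff 0 (charlierSer s p) = 1 ∧ coeff 1 (charlierSer s p) = 0 ∧
    coeff 2 (charlierSer s p) = -((∑ i ∈ s, p i ^ 2) / 2) ∧
    coeff 3 (charlierSer s p) = (∑ i ∈ s, p i ^ 3) / 3 := by
  classical
  induction s using Finset.induction_on with
  | empty => simp [charlierSer, expSer_zero, coeff_one]
  | insert a s ha ih =>
    obtain ⟨h0, h1, h2, h3⟩ := ih
    obtain ⟨f0, f1, f2, f3⟩ := coeff_charlier_factor (p a)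
    rw [charlierSer_insert p ha, Finset.sum_insert ha, Finset.sum_insert ha]
    refine ⟨?_, ?_, ?_, ?_⟩ <;>
    · rw [coeff_mul, Finset.Nat.sum_antidiagonal_eq_sum_range_succ_mk]
      simp only [Finset.sum_range_succ, Finset.sum_range_zero, Nat.sub_self, Nat.sub_zero,
        Nat.reduceSub, h0, h1, h2, h3, f0, f1, f2, f3]
      ring

lemma hasSum_charlierSer_complex (s : Finset I) (p : I → ℝ) (z : ℂ) :
    HasSum (fun j => z ^ j • ((coeff j (charlierSer s p) : ℝ) : ℂ))
      (∏ i ∈ s, (1 + p i * z) * Complex.exp (-(p i * z))) := by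
  classical
  set l := ∑ i ∈ s, p i with hldef
  have key : ∀ t : Finset I, HasSum (fun j => z ^ j •
      ((coeff j ((∏ i ∈ t, (1 + C (p i) * X)) * expSer (-l)) : ℝ) : ℂ))
      ((∏ i ∈ t, (1 + p i * z)) * Complex.exp (-(l * z))) := by
    intro t
    induction t using Finset.induction_on with
    | empty =>
      simp only [Finset.prod_empty, one_mul, coeff_expSer]
      have h := NormedSpace.expSeries_div_hasSum_exp (-(l * z) : ℂ)
      rw [← Complex.exp_eq_exp_ℂ] at h
      refine h.congr_fun fun j => ?_
      push_cast
      rw [smul_eq_mul, ← neg_mul, mul_pow]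
      ring
    | insert a t ha ih =>
      rw [Finset.prod_insert ha, Finset.prod_insert ha]
      have h2 : HasSum (fun j => z ^ j •
          ((coeff j (X * ((∏ i ∈ t, (1 + C (p i) * X)) * expSer (-l))) : ℝ) : ℂ))
          (z * ((∏ i ∈ t, (1 + p i * z)) * Complex.exp (-(l * z)))) := by
        rw [← hasSum_nat_add_iff' 1]
        simp only [coeff_succ_X_mul, Finset.range_one, Finset.sum_singleton, coeff_zero_X_mul,
          Complex.ofReal_zero, smul_zero, sub_zero]
        refine (ih.mul_left z).congr_fun fun j => ?_
        simp only [smul_eq_mul]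
        ring
      have h3 := ih.add (h2.mul_left (p a : ℂ))
      have e : (1 + (p a : ℂ) * z) * (∏ i ∈ t, (1 + p i * z)) * Complex.exp (-(l * z)) =
          (∏ i ∈ t, (1 + p i * z)) * Complex.exp (-(l * z)) +
          p a * (z * ((∏ i ∈ t, (1 + p i * z)) * Complex.exp (-(l * z)))) := by ring
      rw [e]
      refine h3.congr_fun fun j => ?_
      rw [mul_assoc, add_mul, one_mul, mul_assoc, map_add, coeff_C_mul]
      simp only [smul_eq_mul]
      push_cast
      ring
  have e : (∏ i ∈ s, (1 + p i * z) * Complex.exp (-(p i * z))) =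
      (∏ i ∈ s, (1 + p i * z)) * Complex.exp (-(l * z)) := by
    rw [Finset.prod_mul_distrib, ← Complex.exp_sum, Finset.sum_neg_distrib, ← Finset.sum_mul,
      hldef]
    push_cast
    rfl
  rw [e]
  exact key s

/-- Squared, the left side is (1 + 2 Re w + |w|²) e^{-2 Re w}, and 1 + x ≤ e^x applies. -/
lemma norm_one_add_mul_exp_neg_le (w : ℂ) :
    ‖(1 + w) * Complex.exp (-w)‖ ≤ Real.exp (‖w‖ ^ 2 / 2) := by
  apply le_of_sq_le_sq _ (by positivity)
  rw [norm_mul, mul_pow, Complex.norm_exp, ← Real.exp_nat_mul, ← Real.exp_nat_mul,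
    Complex.sq_norm, Complex.sq_norm]
  have h1 : Complex.normSq (1 + w) = 1 + (2 * w.re + Complex.normSq w) := by
    simp [Complex.normSq_apply]; ring
  have h2 := Real.add_one_le_exp (2 * w.re + Complex.normSq w)
  calc Complex.normSq (1 + w) * Real.exp ((2 : ℕ) * (-w).re)
      ≤ Real.exp (2 * w.re + Complex.normSq w) * Real.exp ((2 : ℕ) * (-w).re) := by
        apply mul_le_mul_of_nonneg_right _ (Real.exp_nonneg _)
        linarith
    _ = _ := by
        rw [← Real.exp_add]
        congr 1
        simp
        ring

/-- Cauchy's estimate on the circle of radius R for the entire function whose Taylor coefficients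
these are. -/
lemma abs_coeff_charlierSer_le (s : Finset I) (p : I → ℝ) {R : ℝ} (hR : 0 < R) (j : ℕ) :
    |coeff j (charlierSer s p)| ≤ Real.exp ((∑ i ∈ s, p i ^ 2) * R ^ 2 / 2) / R ^ j := by
  set g : ℂ → ℂ := fun z => ∏ i ∈ s, (1 + p i * z) * Complex.exp (-(p i * z)) with hg
  have hgd : Differentiable ℂ g := by
    rw [hg]
    fun_prop
  have h1 : HasFPowerSeriesAt g (FormalMultilinearSeries.ofScalars ℂ
      fun j => ((coeff j (charlierSer s p) : ℝ) : ℂ)) 0 := by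
    rw [hasFPowerSeriesAt_iff]
    refine Filter.Eventually.of_forall fun z => ?_
    simp only [FormalMultilinearSeries.coeff_ofScalars, zero_add]
    exact hasSum_charlierSer_complex s p z
  have h2 := (hgd.analyticAt 0).hasFPowerSeriesAt
  have h3 := h1.eq_formalMultilinearSeries h2
  have h4 : ((coeff j (charlierSer s p) : ℝ) : ℂ) = iteratedDeriv j g 0 / j.factorial := by
    have := congrArg (fun q => FormalMultilinearSeries.coeff q j) h3
    simpa only [FormalMultilinearSeries.coeff_ofScalars] using this
  have h5 : ∀ z ∈ Metric.sphere (0 : ℂ) R,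
      ‖g z‖ ≤ Real.exp ((∑ i ∈ s, p i ^ 2) * R ^ 2 / 2) := by
    intro z hz
    rw [mem_sphere_zero_iff_norm] at hz
    rw [hg, norm_prod, Finset.sum_mul, Finset.sum_div, Real.exp_sum]
    refine Finset.prod_le_prod (fun i _ => norm_nonneg _) fun i _ => ?_
    refine (norm_one_add_mul_exp_neg_le _).trans_eq ?_
    rw [norm_mul, hz, Complex.norm_real, Real.norm_eq_abs, mul_pow, sq_abs]
  have h6 := Complex.norm_iteratedDeriv_le_of_forall_mem_sphere_norm_le j hR hgd.diffContOnCl h5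
  have h7 : |coeff j (charlierSer s p)| = ‖iteratedDeriv j g 0‖ / j.factorial := by
    rw [← Real.norm_eq_abs, ← Complex.norm_real, h4, norm_div, Complex.norm_natCast]
  rw [h7, div_le_iff₀ (by positivity)]
  refine h6.trans_eq ?_
  ring

lemma sq_coeff_charlierSer_le (s : Finset I) (p : I → ℝ) (hq : 0 < ∑ i ∈ s, p i ^ 2) {j : ℕ}
    (hj : j ≠ 0) :
    coeff j (charlierSer s p) ^ 2 ≤ (Real.exp 1 * (∑ i ∈ s, p i ^ 2) / j) ^ j := by
  set q := ∑ i ∈ s, p i ^ 2 with hqdef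
  have hj0 : (0 : ℝ) < j := by positivity
  -- The radius √(j/q) minimises e^{qR²/2}/R^j.
  have hR : 0 < Real.sqrt (j / q) := by positivity
  have h := abs_coeff_charlierSer_le s p hR j
  rw [← sq_abs]
  refine (pow_le_pow_left₀ (abs_nonneg _) h 2).trans_eq ?_
  rw [div_pow, ← pow_mul, mul_comm j 2, pow_mul, Real.sq_sqrt (by positivity), ← hqdef,
    ← Real.exp_nat_mul, mul_div_cancel₀ _ hq.ne', div_pow, div_pow, mul_pow,
    ← Real.exp_nat_mul, mul_one]
  push_cast
  rw [mul_div_cancel₀ (j : ℝ) two_ne_zero]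
  field_simp

end Expansion

/-! ### The remainder of the expansion and Roos' bound. -/

lemma binomial_poly_le_rpow {x : ℝ} (h0 : 0 ≤ x) (h1 : x ≤ 0.577) :
    1 + 3 / 2 * x + 15 / 8 * x ^ 2 + 35 / 16 * x ^ 3 + 315 / 128 * x ^ 4 ≤
      1 / (1 - x) ^ (3 / 2 : ℝ) := by
  have hx : 0 < 1 - x := by linarith
  set S := (1 - x) ^ (3 / 2 : ℝ) with hS
  have hS0 : 0 < S := Real.rpow_pos_of_pos hx _
  have hS2 : S ^ 2 = (1 - x) ^ 3 := by
    rw [hS, ← Real.rpow_natCast, ← Real.rpow_mul hx.le, ← Real.rpow_natCast]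
    norm_num
  rw [le_div_iff₀ hS0]
  apply le_of_sq_le_sq _ zero_le_one
  rw [mul_pow, hS2]
  have p2 : x ^ 2 ≤ 0.577 ^ 2 := pow_le_pow_left₀ h0 h1 2
  have p3 : x ^ 3 ≤ 0.577 ^ 3 := pow_le_pow_left₀ h0 h1 3
  have p4 : x ^ 4 ≤ 0.577 ^ 4 := pow_le_pow_left₀ h0 h1 4
  have p5 : x ^ 5 ≤ 0.577 ^ 5 := pow_le_pow_left₀ h0 h1 5
  have p6 : 0 ≤ x ^ 6 := by positivity
  -- With P the quartic Taylor polynomial of (1 - x)^(-3/2), this is the cofactor in 1 - P²(1 - x)³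
  -- = x⁵ Q(x).
  have hQ : 0 ≤ 693 / 128 - 1155 / 512 * x - 495 / 1024 * x ^ 2 - 3465 / 16384 * x ^ 3
      - 1925 / 16384 * x ^ 4 - 121275 / 16384 * x ^ 5 + 99225 / 16384 * x ^ 6 := by
    norm_num at p2 p3 p4 p5 h1
    linarith
  have := mul_nonneg (pow_nonneg h0 5) hQ
  linarith

/-- Here x = √θ. Both sides are of order x⁶, with leading constants 2/3 and (9/(4e))² ≈ 0.685;
dividing by x⁶ leaves a polynomial inequality on the range x ≤ 0.577. -/
lemma remainder_numeric_bound {x : ℝ} (h0 : 0 ≤ x) (h1 : x ≤ 0.577) :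
    2 / 3 * (x ^ 2) ^ 3 + Real.exp 1 * (x ^ 2) ^ 4 * (2 / (1 - x ^ 2) +
      x ^ 2 / (4 * (1 - x ^ 2) ^ 2)) ≤
      (3 * x ^ 2 / (2 * Real.exp 1) * (1 / (1 - x) ^ (3 / 2 : ℝ) - 1)) ^ 2 := by
  have hP := binomial_poly_le_rpow h0 h1
  set q := 3 / 2 * x + 15 / 8 * x ^ 2 + 35 / 16 * x ^ 3 + 315 / 128 * x ^ 4 with hq
  have hq0 : 0 ≤ q := by positivity
  have he1 := Real.exp_one_lt_d9
  have he0 := Real.exp_pos 1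
  have hx2 : x ^ 2 ≤ 0.577 ^ 2 := pow_le_pow_left₀ h0 h1 2
  have hx2' : x ^ 2 ≤ 0.332929 := by norm_num at hx2 ⊢; exact hx2
  have hG : 2 / (1 - x ^ 2) + x ^ 2 / (4 * (1 - x ^ 2) ^ 2) ≤ 2 + 3.57 * x ^ 2 := by
    have ht0 : 0 ≤ x ^ 2 := sq_nonneg x
    generalize x ^ 2 = t at hx2' ht0
    have h1t : 0 < 1 - t := by linarith
    rw [div_add_div _ _ h1t.ne' (by positivity), div_le_iff₀ (by positivity)]
    have : 0 ≤ t * (1.32 - 5.14 * t + 3.57 * t ^ 2) := by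
      apply mul_nonneg ht0
      nlinarith
    nlinarith [mul_nonneg h1t.le this]
  have hlow : (3 * x ^ 2 / (2 * Real.exp 1) * q) ^ 2 ≤
      (3 * x ^ 2 / (2 * Real.exp 1) * (1 / (1 - x) ^ (3 / 2 : ℝ) - 1)) ^ 2 := by
    apply pow_le_pow_left₀ (by positivity)
    apply mul_le_mul_of_nonneg_left _ (by positivity)
    linarith
  refine le_trans ?_ hlow
  have hE : (0.3045 : ℝ) ≤ (3 / (2 * Real.exp 1)) ^ 2 := by
    rw [div_pow, le_div_iff₀ (by positivity)]
    nlinarith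
  set w := 3 / 2 + 15 / 8 * x + 35 / 16 * x ^ 2 + 315 / 128 * x ^ 3 with hw
  have hqw : q = x * w := by rw [hq, hw]; ring
  have hpoly : 2 / 3 + 2.7183 * x ^ 2 * (2 + 3.57 * x ^ 2) ≤ 0.3045 * w ^ 2 := by
    have e : 0.3045 * w ^ 2 - (2 / 3 + 2.7183 * x ^ 2 * (2 + 3.57 * x ^ 2)) ≥
        x * (1.71 - 2.37 * x + 4.74 * x ^ 2 - 5.45 * x ^ 3) := by
      rw [hw]
      have a5 : 0 ≤ x ^ 5 := by positivity
      have a6 : 0 ≤ x ^ 6 := by positivity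
      have a4 : 0 ≤ x ^ 4 := by positivity
      have a3 : 0 ≤ x ^ 3 := by positivity
      have a2 : 0 ≤ x ^ 2 := by positivity
      linarith
    have h3 : 0 ≤ 1.71 - 2.37 * x + 4.74 * x ^ 2 - 5.45 * x ^ 3 := by
      nlinarith [mul_nonneg (sq_nonneg x) (sub_nonneg.2 h1), sq_nonneg (x - 0.5)]
    have := mul_nonneg h0 h3
    linarith
  have hfin : 2 / 3 + Real.exp 1 * x ^ 2 * (2 / (1 - x ^ 2) + x ^ 2 / (4 * (1 - x ^ 2) ^ 2)) ≤
      (3 / (2 * Real.exp 1)) ^ 2 * w ^ 2 := by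
    have h4 : Real.exp 1 * x ^ 2 * (2 / (1 - x ^ 2) + x ^ 2 / (4 * (1 - x ^ 2) ^ 2)) ≤
        2.7183 * x ^ 2 * (2 + 3.57 * x ^ 2) := by
      have h5 : Real.exp 1 * x ^ 2 ≤ 2.7183 * x ^ 2 :=
        mul_le_mul_of_nonneg_right (by linarith) (sq_nonneg x)
      exact (mul_le_mul_of_nonneg_left hG (by positivity)).trans
        (mul_le_mul_of_nonneg_right h5 (by positivity))
    have h6 := mul_le_mul_of_nonneg_right hE (sq_nonneg w)
    linarith
  have := mul_le_mul_of_nonneg_left hfin (by positivity : 0 ≤ x ^ 6)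
  calc _ = x ^ 6 * (2 / 3 + Real.exp 1 * x ^ 2 *
        (2 / (1 - x ^ 2) + x ^ 2 / (4 * (1 - x ^ 2) ^ 2))) := by ring
    _ ≤ _ := this
    _ = _ := by rw [hqw]; ring

lemma sq_sum_cube_le {I : Type*} (s : Finset I) (p : I → ℝ) :
    (∑ i ∈ s, p i ^ 3) ^ 2 ≤ (∑ i ∈ s, p i ^ 2) ^ 3 := by
  have h1 := Finset.sum_mul_sq_le_sq_mul_sq s p (fun i => p i ^ 2)
  have h2 := Finset.sum_sq_le_sq_sum_of_nonneg (s := s) (f := fun i => p i ^ 2)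
    (fun i _ => sq_nonneg _)
  have e : ∑ i ∈ s, p i * p i ^ 2 = ∑ i ∈ s, p i ^ 3 := Finset.sum_congr rfl fun i _ => by ring
  rw [e] at h1
  have h3 : 0 ≤ ∑ i ∈ s, p i ^ 2 := Finset.sum_nonneg fun i _ => sq_nonneg _
  calc _ ≤ _ := h1
    _ ≤ (∑ i ∈ s, p i ^ 2) * (∑ i ∈ s, p i ^ 2) ^ 2 := mul_le_mul_of_nonneg_left h2 h3
    _ = _ := by ring

/-- For j ≥ 4 the Cauchy bound and Stirling give terms at most e √j θ^j, and √(4 + i) ≤ 2 + i/4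
makes the series summable in closed form. For j = 3 the exact coefficient is used. -/
lemma sum_sq_coeff_charlierSer_le {I : Type*} (s : Finset I) (p : I → ℝ)
    {l q θ : ℝ} (hl : 0 < l) (hqdef : q = ∑ i ∈ s, p i ^ 2) (hq : 0 < q) (hθ : θ = q / l)
    (hθ1 : θ < 1) (N : ℕ) :
    ∑ j ∈ Finset.Ico 3 N, PowerSeries.coeff j (charlierSer s p) ^ 2 * (j.factorial / l ^ j) ≤
      2 / 3 * θ ^ 3 + Real.exp 1 * θ ^ 4 * (2 / (1 - θ) + θ / (4 * (1 - θ) ^ 2)) := by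
  have hθ0 : 0 < θ := by rw [hθ]; positivity
  have hql : q = θ * l := by rw [hθ]; field_simp
  have hlast : HasSum (fun i : ℕ => Real.exp 1 * θ ^ 4 * (2 * θ ^ i + 1 / 4 * (i * θ ^ i)))
      (Real.exp 1 * θ ^ 4 * (2 / (1 - θ) + θ / (4 * (1 - θ) ^ 2))) := by
    have h1 := (hasSum_geometric_of_lt_one hθ0.le hθ1).mul_left 2
    have h2 := (hasSum_coe_mul_geometric_of_norm_lt_one (r := θ)
      (by rw [Real.norm_eq_abs, abs_of_pos hθ0]; exact hθ1)).mul_left (1 / 4)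
    have h3 := (h1.add h2).mul_left (Real.exp 1 * θ ^ 4)
    rwa [← div_eq_mul_inv, div_mul_div_comm, one_mul] at h3
  have hterm : ∀ i : ℕ, PowerSeries.coeff (4 + i) (charlierSer s p) ^ 2 *
      ((4 + i).factorial / l ^ (4 + i)) ≤
      Real.exp 1 * θ ^ 4 * (2 * θ ^ i + 1 / 4 * (i * θ ^ i)) := by
    intro i
    have hj : 4 + i ≠ 0 := by omega
    have hj0 : (0 : ℝ) < (4 + i : ℕ) := by positivity
    have h1 := sq_coeff_charlierSer_le s p (hqdef ▸ hq) hj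
    rw [← hqdef] at h1
    have h2 := factorial_le_stirling hj
    have h3 : Real.sqrt (4 + i : ℕ) ≤ 2 + i / 4 := by
      rw [Real.sqrt_le_left (by positivity)]
      push_cast
      nlinarith [sq_nonneg (i : ℝ)]
    calc _ ≤ (Real.exp 1 * q / (4 + i : ℕ)) ^ (4 + i) * ((Real.exp 1 * Real.sqrt (4 + i : ℕ) *
          ((4 + i : ℕ) / Real.exp 1) ^ (4 + i)) / l ^ (4 + i)) := by
          gcongr
      _ = Real.exp 1 * Real.sqrt (4 + i : ℕ) * θ ^ (4 + i) := by
          rw [hql]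
          generalize Real.sqrt ((4 + i : ℕ) : ℝ) = r
          have : (Real.exp 1 * (θ * l) / (4 + i : ℕ)) ^ (4 + i) *
            ((4 + i : ℕ) / Real.exp 1) ^ (4 + i) = θ ^ (4 + i) * l ^ (4 + i) := by
            rw [← mul_pow, ← mul_pow]
            congr 1
            field_simp
          field_simp
          linear_combination r * this
      _ ≤ Real.exp 1 * (2 + i / 4) * θ ^ (4 + i) := by gcongr
      _ = _ := by rw [pow_add]; ring
  have h3 : PowerSeries.coeff 3 (charlierSer s p) ^ 2 * ((3 : ℕ).factorial / l ^ 3) ≤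
      2 / 3 * θ ^ 3 := by
    rw [(coeff_charlierSer s p).2.2.2]
    have h := sq_sum_cube_le s p
    rw [← hqdef, hql] at h
    rw [← mul_div_assoc, div_le_iff₀ (by positivity)]
    simp only [Nat.factorial]
    push_cast
    nlinarith
  rcases le_or_gt N 3 with hN | hN
  · rw [Finset.Ico_eq_empty_of_le hN, Finset.sum_empty]
    have : 0 < 1 - θ := by linarith
    positivity
  · rw [Finset.sum_eq_sum_Ico_succ_bot hN, Finset.sum_Ico_eq_sum_range]
    refine add_le_add h3 ((Finset.sum_le_sum fun i _ => hterm i).trans ?_)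
    exact sum_le_hasSum _ (fun i _ => by positivity) hlast

/-- Roos' bound for the total variation distance between the law of a sum of independent Bernoulli
variables and a Poisson law. -/
lemma sum_abs_bernSer_sub_poisWt_le {I : Type*} (s : Finset I) (p : I → ℝ)
    {l θ : ℝ} (hl : l = ∑ i ∈ s, p i) (hl0 : 0 < l) (hq : 0 < ∑ i ∈ s, p i ^ 2)
    (hθ : θ = (∑ i ∈ s, p i ^ 2) / l) (hθ1 : Real.sqrt θ ≤ 0.577) (K : Finset ℕ) :
    ∑ k ∈ K, |PowerSeries.coeff k (bernSer s p) - poisWt l k| ≤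
      2 * (θ * (3 / (4 * Real.exp 1 * (1 - Real.sqrt θ) ^ (3 / 2 : ℝ)))) := by
  set a := fun j => PowerSeries.coeff j (charlierSer s p) with ha
  set u := fun j k => poisWt l k * charlier l j k with hu
  set x := Real.sqrt θ with hx
  have hθ0 : 0 < θ := by rw [hθ]; positivity
  have hxx : θ = x ^ 2 := (Real.sq_sqrt hθ0.le).symm
  have hx0 : 0 ≤ x := Real.sqrt_nonneg _
  -- The expansion is known only pointwise, hence the finite set K and the limit over partial sums.
  have hlim : Filter.Tendsto (fun N => ∑ k ∈ K, |∑ j ∈ Finset.range N, a j * u j k - poisWt l k|)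
      Filter.atTop (nhds (∑ k ∈ K, |PowerSeries.coeff k (bernSer s p) - poisWt l k|)) := by
    refine tendsto_finsetSum _ fun k _ => ?_
    have h := hasSum_charlierSer s p (by rw [← hl]; exact hl0.ne') k
    rw [← hl] at h
    exact (h.tendsto_sum_nat.sub_const _).abs
  refine le_of_tendsto hlim ?_
  filter_upwards [Filter.eventually_ge_atTop 3] with N hN
  obtain ⟨h0, h1, h2, _⟩ := coeff_charlierSer s p
  have hsplit : ∀ k, ∑ j ∈ Finset.range N, a j * u j k - poisWt l k =
      a 2 * u 2 k + ∑ j ∈ Finset.Ico 3 N, a j * u j k := by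
    intro k
    rw [← Finset.sum_range_add_sum_Ico _ hN]
    simp only [Finset.sum_range_succ, Finset.sum_range_zero, ha, h0, h1, hu, charlier_zero]
    ring
  have hthird : Real.sqrt (∑ j ∈ Finset.Ico 3 N, a j ^ 2 * (j.factorial / l ^ j)) ≤
      3 * x ^ 2 / (2 * Real.exp 1) * (1 / (1 - x) ^ (3 / 2 : ℝ) - 1) := by
    have hb := sum_sq_coeff_charlierSer_le s p hl0 rfl hq hθ (by rw [hxx]; nlinarith) N
    rw [hxx] at hb
    have hb2 := hb.trans (remainder_numeric_bound hx0 hθ1)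
    have hnn : 0 ≤ 1 / (1 - x) ^ (3 / 2 : ℝ) - 1 := by
      have := binomial_poly_le_rpow hx0 hθ1
      have : 0 ≤ 3 / 2 * x + 15 / 8 * x ^ 2 + 35 / 16 * x ^ 3 + 315 / 128 * x ^ 4 := by positivity
      linarith
    rw [Real.sqrt_le_left (by positivity)]
    exact hb2
  have hS : 0 < (1 - x) ^ (3 / 2 : ℝ) := Real.rpow_pos_of_pos (by linarith) _
  calc ∑ k ∈ K, |∑ j ∈ Finset.range N, a j * u j k - poisWt l k|
      ≤ ∑ k ∈ K, (|a 2| * |u 2 k| + |∑ j ∈ Finset.Ico 3 N, a j * u j k|) := by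
        refine Finset.sum_le_sum fun k _ => ?_
        rw [hsplit, ← abs_mul]
        exact abs_add_le _ _
    _ = |a 2| * ∑ k ∈ K, |u 2 k| + ∑ k ∈ K, |∑ j ∈ Finset.Ico 3 N, a j * u j k| := by
        rw [Finset.sum_add_distrib, Finset.mul_sum]
    _ ≤ θ * l / 2 * (3 / Real.exp 1 / l) +
        3 * x ^ 2 / (2 * Real.exp 1) * (1 / (1 - x) ^ (3 / 2 : ℝ) - 1) := by
        refine add_le_add (mul_le_mul (le_of_eq ?_) (sum_abs_charlier_two_le hl0 K)
          (Finset.sum_nonneg fun _ _ => abs_nonneg _) (by positivity))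
          ((sum_abs_charlier_le hl0 a _ K).trans hthird)
        simp only [ha]
        rw [h2, abs_neg, abs_of_nonneg (by positivity), hθ]
        field_simp
    _ = _ := by
        rw [hxx]
        field_simp
        ring

/-! ### Expectations under a Bernoulli sum and Stein's identity. -/

section BernoulliSum

variable {I : Type*}

lemma bernSer_insert [DecidableEq I] {s : Finset I} (p : I → ℝ) {a : I} (ha : a ∉ s) :
    bernSer (insert a s) p = (1 + PowerSeries.C (p a) * (PowerSeries.X - 1)) * bernSer s p := by
  unfold bernSer
  rw [Finset.prod_insert ha]

lemma coeff_zero_bernSer_insert [DecidableEq I] {s : Finset I} (p : I → ℝ) {a : I} (ha : a ∉ s) :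
    PowerSeries.coeff 0 (bernSer (insert a s) p) =
      (1 - p a) * PowerSeries.coeff 0 (bernSer s p) := by
  rw [bernSer_insert p ha, add_mul, one_mul, mul_assoc, map_add, PowerSeries.coeff_C_mul,
    coeff_X_sub_one_mul_zero]
  ring

lemma coeff_succ_bernSer_insert [DecidableEq I] {s : Finset I} (p : I → ℝ) {a : I} (ha : a ∉ s)
    (k : ℕ) : PowerSeries.coeff (k + 1) (bernSer (insert a s) p) =
      (1 - p a) * PowerSeries.coeff (k + 1) (bernSer s p) +
        p a * PowerSeries.coeff k (bernSer s p) := by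
  rw [bernSer_insert p ha, add_mul, one_mul, mul_assoc, map_add, PowerSeries.coeff_C_mul,
    coeff_X_sub_one_mul_succ]
  ring

lemma coeff_bernSer_empty (p : I → ℝ) (k : ℕ) :
    PowerSeries.coeff k (bernSer ∅ p) = if k = 0 then 1 else 0 := by
  simp [bernSer, PowerSeries.coeff_one]

lemma coeff_bernSer_eq_zero (s : Finset I) (p : I → ℝ) {k : ℕ} (hk : s.card < k) :
    PowerSeries.coeff k (bernSer s p) = 0 := by
  classical
  induction s using Finset.induction_on generalizing k with
  | empty => rw [coeff_bernSer_empty, if_neg (by simp at hk; omega)]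
  | insert a s ha ih =>
    rw [Finset.card_insert_of_notMem ha] at hk
    obtain ⟨k, rfl⟩ := Nat.exists_eq_succ_of_ne_zero (by omega : k ≠ 0)
    rw [Nat.succ_eq_add_one, coeff_succ_bernSer_insert p ha, ih (by omega), ih (by omega)]
    ring

lemma coeff_bernSer_nonneg (s : Finset I) (p : I → ℝ) (h0 : ∀ i, 0 ≤ p i) (h1 : ∀ i, p i ≤ 1)
    (k : ℕ) : 0 ≤ PowerSeries.coeff k (bernSer s p) := by
  classical
  induction s using Finset.induction_on generalizing k with
  | empty => rw [coeff_bernSer_empty]; split_ifs <;> norm_num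
  | insert a s ha ih =>
    rcases k with _ | k
    · rw [coeff_zero_bernSer_insert p ha]
      exact mul_nonneg (sub_nonneg.2 (h1 a)) (ih 0)
    · rw [coeff_succ_bernSer_insert p ha]
      exact add_nonneg (mul_nonneg (sub_nonneg.2 (h1 a)) (ih _)) (mul_nonneg (h0 a) (ih _))

/-- The expectation of `f` under the law of a sum of independent Bernoulli variables. -/
noncomputable def bernExp (s : Finset I) (p : I → ℝ) (f : ℕ → ℝ) : ℝ :=
  ∑ k ∈ Finset.range (s.card + 1), PowerSeries.coeff k (bernSer s p) * f k

lemma bernExp_eq_sum_range (s : Finset I) (p : I → ℝ) (f : ℕ → ℝ) {N : ℕ} (hN : s.card < N) :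
    bernExp s p f = ∑ k ∈ Finset.range N, PowerSeries.coeff k (bernSer s p) * f k := by
  refine Finset.sum_subset (Finset.range_mono hN) fun k _ hk => ?_
  rw [Finset.mem_range, not_lt] at hk
  rw [coeff_bernSer_eq_zero s p hk, zero_mul]

lemma bernExp_empty (p : I → ℝ) (f : ℕ → ℝ) : bernExp ∅ p f = f 0 := by
  simp [bernExp, coeff_bernSer_empty]

lemma bernExp_insert [DecidableEq I] {s : Finset I} (p : I → ℝ) {a : I} (ha : a ∉ s) (f : ℕ → ℝ) :
    bernExp (insert a s) p f =
      (1 - p a) * bernExp s p f + p a * bernExp s p fun k => f (k + 1) := by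
  rw [bernExp, Finset.card_insert_of_notMem ha,
    bernExp_eq_sum_range s p f (show s.card < s.card + 1 + 1 by omega), bernExp,
    Finset.sum_range_succ', Finset.sum_range_succ' _ (s.card + 1), coeff_zero_bernSer_insert p ha]
  simp only [coeff_succ_bernSer_insert p ha, add_mul, Finset.sum_add_distrib, Finset.mul_sum,
    mul_add, mul_assoc]
  ring

lemma bernExp_mono (s : Finset I) (p : I → ℝ) (h0 : ∀ i, 0 ≤ p i) (h1 : ∀ i, p i ≤ 1)
    {f g : ℕ → ℝ} (h : ∀ k, f k ≤ g k) : bernExp s p f ≤ bernExp s p g :=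
  Finset.sum_le_sum fun k _ =>
    mul_le_mul_of_nonneg_left (h k) (coeff_bernSer_nonneg s p h0 h1 k)

lemma bernExp_add (s : Finset I) (p : I → ℝ) (f g : ℕ → ℝ) :
    bernExp s p (fun k => f k + g k) = bernExp s p f + bernExp s p g := by
  simp only [bernExp, mul_add, Finset.sum_add_distrib]

lemma bernExp_sub (s : Finset I) (p : I → ℝ) (f g : ℕ → ℝ) :
    bernExp s p (fun k => f k - g k) = bernExp s p f - bernExp s p g := by
  simp only [bernExp, mul_sub, Finset.sum_sub_distrib]

lemma bernExp_const_mul (s : Finset I) (p : I → ℝ) (c : ℝ) (f : ℕ → ℝ) :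
    bernExp s p (fun k => c * f k) = c * bernExp s p f := by
  simp only [bernExp, Finset.mul_sum]
  exact Finset.sum_congr rfl fun k _ => by ring

lemma bernExp_const (s : Finset I) (p : I → ℝ) (c : ℝ) : bernExp s p (fun _ => c) = c := by
  classical
  induction s using Finset.induction_on with
  | empty => rw [bernExp_empty]
  | insert a s ha ih => rw [bernExp_insert p ha, ih]; ring

/-- Stein's identity for Bernoulli sums, as a bound for functions with increments at most `c`. -/
lemma bernExp_stein_le (s : Finset I) (p : I → ℝ) (h0 : ∀ i, 0 ≤ p i) (h1 : ∀ i, p i ≤ 1) {c : ℝ}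
    (f : ℕ → ℝ) (hf : ∀ m, f (m + 2) - f (m + 1) ≤ c) :
    bernExp s p (fun k => (∑ i ∈ s, p i) * f (k + 1) - k * f k) ≤ c * ∑ i ∈ s, p i ^ 2 := by
  classical
  -- Conditioning on the new variable being 1 replaces f by its shift.
  induction s using Finset.induction_on generalizing f with
  | empty => simp [bernExp_empty]
  | insert a s ha ih =>
    rw [bernExp_insert p ha, Finset.sum_insert ha, Finset.sum_insert ha]
    set l := ∑ i ∈ s, p i
    have i1 := mul_le_mul_of_nonneg_left (ih f hf) (sub_nonneg.2 (h1 a))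
    have i2 := mul_le_mul_of_nonneg_left (ih (fun k => f (k + 1)) fun m => hf (m + 1)) (h0 a)
    have i3 : bernExp s p (fun k => f (k + 2) - f (k + 1)) ≤ c :=
      (bernExp_mono s p h0 h1 hf).trans_eq (bernExp_const s p c)
    have i4 := mul_le_mul_of_nonneg_left i3 (sq_nonneg (p a))
    have e1 : bernExp s p (fun k => (p a + l) * f (k + 1) - k * f k) =
        bernExp s p (fun k => l * f (k + 1) - k * f k) + p a * bernExp s p fun k => f (k + 1) := by
      rw [← bernExp_const_mul, ← bernExp_add]
      congr 1; ext k; ring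
    have e2 : bernExp s p (fun k => (p a + l) * f (k + 1 + 1) - (k + 1 : ℕ) * f (k + 1)) =
        bernExp s p (fun k => l * f (k + 1 + 1) - k * f (k + 1)) +
          (p a * bernExp s p (fun k => f (k + 2) - f (k + 1)) -
          (1 - p a) * bernExp s p fun k => f (k + 1)) := by
      rw [← bernExp_const_mul, ← bernExp_const_mul, ← bernExp_sub, ← bernExp_add]
      congr 1; ext k; push_cast; ring
    rw [e1, e2]
    linarith

end BernoulliSum

/-! ### Stein's method for the Poisson law. -/

section Stein

/-- Log-concavity of the weights. Summed over r, it makes the two branches of `steinSol` monotone.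
-/
lemma poisWt_succ_mul_le {l : ℝ} (hl : 0 < l) {m r : ℕ} (h : m ≤ r) :
    poisWt l (r + 1) * poisWt l m ≤ poisWt l r * poisWt l (m + 1) := by
  rw [poisWt_succ, poisWt_succ l m]
  have h1 : l / ((r : ℝ) + 1) ≤ l / (m + 1) := by gcongr
  have h2 := mul_le_mul_of_nonneg_right h1
    (mul_nonneg (poisWt_nonneg hl.le r) (poisWt_nonneg hl.le m))
  linarith

lemma poisTail_succ_mul_le {l : ℝ} (hl : 0 < l) (m : ℕ) :
    poisTail l (m + 2) * poisWt l m ≤ poisTail l (m + 1) * poisWt l (m + 1) := by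
  unfold poisTail
  rw [← tsum_mul_right, ← tsum_mul_right]
  refine ((summable_poisWt_add l (m + 2)).mul_right _).tsum_le_tsum (fun k => ?_)
    ((summable_poisWt_add l (m + 1)).mul_right _)
  exact poisWt_succ_mul_le hl (show m ≤ k + (m + 1) by omega)

lemma sum_range_poisWt_mul_le {l : ℝ} (hl : 0 < l) (m : ℕ) :
    (∑ r ∈ Finset.range (m + 1), poisWt l r) * poisWt l (m + 1) ≤
      (∑ r ∈ Finset.range (m + 2), poisWt l r) * poisWt l m := by
  rw [Finset.sum_range_succ' _ (m + 1), add_mul, Finset.sum_mul, Finset.sum_mul]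
  have h1 : ∀ r ∈ Finset.range (m + 1), poisWt l r * poisWt l (m + 1) ≤
      poisWt l (r + 1) * poisWt l m := by
    intro r hr
    have := poisWt_succ_mul_le hl (show r ≤ m by rw [Finset.mem_range] at hr; omega)
    linarith
  have h2 := Finset.sum_le_sum h1
  have h3 := mul_nonneg (poisWt_nonneg hl.le 0) (poisWt_nonneg hl.le m)
  linarith

/-- The solution of Stein's equation for the Poisson law and the indicator of `{j}`. -/
noncomputable def steinSol (l : ℝ) (j : ℕ) : ℕ → ℝ
  | 0 => 0
  | k + 1 => if k < j then -(poisWt l j * (∑ r ∈ Finset.range (k + 1), poisWt l r)) / (l * poisWt l k)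
      else poisWt l j * poisTail l (k + 1) / (l * poisWt l k)

lemma steinSol_eq {l : ℝ} (hl : 0 < l) (j k : ℕ) :
    l * steinSol l j (k + 1) - k * steinSol l j k = (if k = j then 1 else 0) - poisWt l j := by
  have hk := poisWt_pos hl k
  rcases k with _ | k
  · simp only [steinSol]
    have ht := sum_range_add_poisTail l 1
    rcases j with _ | j
    · simp at ht ⊢
      field_simp
      linarith
    · simp
      field_simp
  · have hk' := poisWt_pos hl k
    have hs := succ_mul_poisWt_succ l k
    have e : ∀ c : ℝ, ((k + 1 : ℕ) : ℝ) * (c / (l * poisWt l k)) = c / poisWt l (k + 1) := by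
      intro c
      rw [← hs]; push_cast; field_simp
    have e' : ∀ c : ℝ, l * (c / (l * poisWt l (k + 1))) = c / poisWt l (k + 1) := by
      intro c; field_simp
    simp only [steinSol]
    rcases lt_trichotomy (k + 1) j with h | h | h
    · rw [if_pos h, if_pos (by omega), if_neg (by omega), e, e', Finset.sum_range_succ _ (k + 1)]
      field_simp
      ring
    · rw [if_neg (by omega), if_pos (by omega), if_pos h, e, e', ← h]
      have ht := sum_range_add_poisTail l (k + 1 + 1)
      rw [Finset.sum_range_succ] at ht
      field_simp
      linarith
    · rw [if_neg (by omega), if_neg (by omega), if_neg (by omega), e, e',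
        poisTail_eq_add l (k + 1)]
      field_simp
      ring

/-- The solution for {j} decreases except for one upward jump, from j to j + 1. For a set A, each
increment therefore receives at most one positive contribution. -/
lemma steinSol_sub_le {l : ℝ} (hl : 0 < l) (j m : ℕ) :
    steinSol l j (m + 2) - steinSol l j (m + 1) ≤
      if j = m + 1 then (1 - Real.exp (-l)) / l else 0 := by
  have hm := poisWt_pos hl m
  have hm' := poisWt_pos hl (m + 1)
  have hj := poisWt_pos hl j
  simp only [steinSol]
  rcases lt_trichotomy (m + 1) j with h | h | h
  · rw [if_pos h, if_pos (by omega), if_neg (by omega), sub_nonpos,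
      div_le_div_iff₀ (by positivity) (by positivity)]
    have := mul_le_mul_of_nonneg_left (sum_range_poisWt_mul_le hl m) (mul_nonneg hj.le hl.le)
    linarith
  · rw [if_neg (by omega), if_pos (by omega), if_pos h.symm, ← h]
    have h1 : poisWt l (m + 1) / poisWt l m = l / (m + 1) := by
      rw [poisWt_succ]; field_simp
    have e : poisWt l (m + 1) * poisTail l (m + 1 + 1) / (l * poisWt l (m + 1)) -
        -(poisWt l (m + 1) * ∑ r ∈ Finset.range (m + 1), poisWt l r) / (l * poisWt l m) =
        (poisTail l (m + 2) + l / (m + 1) * ∑ r ∈ Finset.range (m + 1), poisWt l r) / l := by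
      rw [← h1]; field_simp; ring
    rw [e]
    have h2 : l / (m + 1) * ∑ r ∈ Finset.range (m + 1), poisWt l r ≤
        ∑ r ∈ Finset.range (m + 1), poisWt l (r + 1) := by
      rw [Finset.mul_sum]
      refine Finset.sum_le_sum fun r hr => ?_
      rw [poisWt_succ]
      have hr' : (r : ℝ) ≤ m := by
        rw [Finset.mem_range] at hr; exact_mod_cast (by omega : r ≤ m)
      gcongr
      exact poisWt_nonneg hl.le r
    have h3 := sum_range_add_poisTail l (m + 2)
    rw [Finset.sum_range_succ', poisWt_zero] at h3
    gcongr
    linarith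
  · rw [if_neg (by omega), if_neg (by omega), if_neg (by omega), sub_nonpos,
      div_le_div_iff₀ (by positivity) (by positivity)]
    have := mul_le_mul_of_nonneg_left (poisTail_succ_mul_le hl m) (mul_nonneg hj.le hl.le)
    linarith

/-- The Barbour–Hall bound for the total variation distance between the law of a sum of independent
Bernoulli variables and a Poisson law. -/
lemma sum_bernSer_sub_poisWt_le {I : Type*} (s : Finset I) (p : I → ℝ) (h0 : ∀ i, 0 ≤ p i)
    (h1 : ∀ i, p i ≤ 1) {l θ : ℝ} (hl : l = ∑ i ∈ s, p i) (hl0 : 0 < l)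
    (hθ : θ = (∑ i ∈ s, p i ^ 2) / l) (A : Finset ℕ) (hA : A ⊆ Finset.range (s.card + 1)) :
    ∑ k ∈ A, (PowerSeries.coeff k (bernSer s p) - poisWt l k) ≤ θ * (1 - Real.exp (-l)) := by
  have hc : 0 ≤ (1 - Real.exp (-l)) / l :=
    div_nonneg (sub_nonneg.2 (Real.exp_le_one_iff.2 (by linarith))) hl0.le
  have h := bernExp_stein_le s p h0 h1 (c := (1 - Real.exp (-l)) / l)
    (fun k => ∑ j ∈ A, steinSol l j k) fun m => by
      rw [← Finset.sum_sub_distrib]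
      refine (Finset.sum_le_sum fun j _ => steinSol_sub_le hl0 j m).trans ?_
      rw [Finset.sum_ite_eq' A (m + 1) fun _ => (1 - Real.exp (-l)) / l]
      split_ifs
      · exact le_rfl
      · exact hc
  rw [← hl] at h
  have e : (fun k : ℕ => l * ∑ j ∈ A, steinSol l j (k + 1) - k * ∑ j ∈ A, steinSol l j k) =
      fun k => (if k ∈ A then 1 else 0) - ∑ j ∈ A, poisWt l j := by
    ext k
    rw [Finset.mul_sum, Finset.mul_sum, ← Finset.sum_sub_distrib]
    simp only [steinSol_eq hl0]
    rw [Finset.sum_sub_distrib, Finset.sum_ite_eq]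
  rw [e, bernExp_sub, bernExp_const] at h
  have e2 : bernExp s p (fun k => if k ∈ A then 1 else 0) =
      ∑ k ∈ A, PowerSeries.coeff k (bernSer s p) := by
    simp only [bernExp, mul_ite, mul_one, mul_zero]
    rw [← Finset.sum_filter, Finset.filter_mem_eq_inter, Finset.inter_eq_right.2 hA]
  rw [Finset.sum_sub_distrib, ← e2]
  refine h.trans_eq ?_
  rw [hθ]
  ring

end Stein

/-! ### Convex order between Bernoulli sums and the Poisson law. -/

section ConvexOrder

lemma summable_poisWt_mul_geom (l R : ℝ) : Summable fun k => poisWt l k * R ^ k := by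
  refine ((hasSum_pow_div_factorial (l * R)).summable.mul_left (Real.exp (-l))).congr fun k => ?_
  rw [poisWt, mul_pow]
  ring

/-- Functions on `ℕ` that are nonnegative, convex and of at most exponential growth. -/
structure IsConvexGrowth (R : ℝ) (f : ℕ → ℝ) : Prop where
  nonneg : ∀ k, 0 ≤ f k
  convex : ∀ k, f (k + 1) - f k ≤ f (k + 2) - f (k + 1)
  growth : ∃ C, ∀ k, f k ≤ C * R ^ k

lemma IsConvexGrowth.summable {R : ℝ} {f : ℕ → ℝ} (hf : IsConvexGrowth R f) {l : ℝ}
    (hl : 0 ≤ l) (k : ℕ) : Summable fun j => poisWt l j * f (k + j) := by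
  obtain ⟨C, hC⟩ := hf.growth
  refine ((summable_poisWt_mul_geom l R).mul_left (C * R ^ k)).of_nonneg_of_le
    (fun j => mul_nonneg (poisWt_nonneg hl j) (hf.nonneg _)) fun j => ?_
  refine (mul_le_mul_of_nonneg_left (hC (k + j)) (poisWt_nonneg hl j)).trans_eq ?_
  rw [pow_add]; ring

lemma IsConvexGrowth.smooth {R : ℝ} {f : ℕ → ℝ} (hf : IsConvexGrowth R f) {l : ℝ}
    (hl : 0 ≤ l) : IsConvexGrowth R fun k => ∑' j, poisWt l j * f (k + j) where
  nonneg k := tsum_nonneg fun j => mul_nonneg (poisWt_nonneg hl j) (hf.nonneg _)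
  convex k := by
    have s0 := hf.summable hl k
    have s1 := hf.summable hl (k + 1)
    have s2 := hf.summable hl (k + 2)
    rw [← s1.tsum_sub s0, ← s2.tsum_sub s1]
    refine (s1.sub s0).tsum_le_tsum (fun j => ?_) (s2.sub s1)
    rw [← mul_sub, ← mul_sub]
    refine mul_le_mul_of_nonneg_left ?_ (poisWt_nonneg hl j)
    have := hf.convex (k + j)
    rwa [show k + j + 1 = k + 1 + j by ring, show k + j + 2 = k + 2 + j by ring] at this
  growth := by
    obtain ⟨C, hC⟩ := hf.growth
    refine ⟨C * ∑' j, poisWt l j * R ^ j, fun k => ?_⟩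
    rw [mul_assoc, mul_comm _ (R ^ k), ← mul_assoc, ← tsum_mul_left]
    refine (hf.summable hl k).tsum_le_tsum (fun j => ?_)
      ((summable_poisWt_mul_geom l R).mul_left _)
    refine (mul_le_mul_of_nonneg_left (hC (k + j)) (poisWt_nonneg hl j)).trans_eq ?_
    rw [pow_add]; ring

lemma IsConvexGrowth.tangent_le {R : ℝ} {f : ℕ → ℝ} (hf : IsConvexGrowth R f) (k j : ℕ) :
    f k + j * (f (k + 1) - f k) ≤ f (k + j) := by
  have hmono : ∀ i, f (k + 1) - f k ≤ f (k + i + 1) - f (k + i) := by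
    intro i
    induction i with
    | zero => exact le_rfl
    | succ i ih => exact ih.trans (hf.convex (k + i))
  induction j with
  | zero => simp
  | succ j ih =>
    have := hmono j
    rw [← add_assoc]
    push_cast
    linarith

/-- The line through the values at k and k + 1 lies below f at all k + j, is exact on the Bernoulli
variable, and has the same mean under both laws. -/
lemma IsConvexGrowth.bernoulli_le {R : ℝ} {f : ℕ → ℝ} (hf : IsConvexGrowth R f) {q : ℝ}
    (hq : 0 ≤ q) (k : ℕ) : (1 - q) * f k + q * f (k + 1) ≤ ∑' j, poisWt q j * f (k + j) := by
  have h1 : HasSum (fun j : ℕ => (j : ℝ) * poisWt q j) q := by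
    have h := hasSum_mul_poisWt_add q 0
    rw [poisTail_zero, mul_one] at h
    rw [← hasSum_nat_add_iff' 1]
    simpa using h
  have h2 : HasSum (fun j : ℕ => poisWt q j * (f k + j * (f (k + 1) - f k)))
      (f k * 1 + (f (k + 1) - f k) * q) := by
    refine (((hasSum_poisWt q).mul_left (f k)).add (h1.mul_left (f (k + 1) - f k))).congr_fun
      fun j => by ring
  have h3 := h2.summable.tsum_le_tsum (fun j => mul_le_mul_of_nonneg_left (hf.tangent_le k j)
    (poisWt_nonneg hq j)) (hf.summable hq k)
  rw [h2.tsum_eq] at h3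
  linarith

lemma sum_antidiagonal_poisWt (l q : ℝ) (m : ℕ) :
    ∑ x ∈ Finset.HasAntidiagonal.antidiagonal m, poisWt l x.1 * poisWt q x.2 = poisWt (l + q) m := by
  have h : poisSer l * poisSer q = poisSer (l + q) := by
    rw [poisSer_eq, poisSer_eq, poisSer_eq, mul_mul_mul_comm, expSer_mul, ← map_mul,
      ← Real.exp_add]
    congr 3
    ring
  have := congrArg (PowerSeries.coeff m) h
  simpa [PowerSeries.coeff_mul, poisSer] using this

lemma IsConvexGrowth.tsum_tsum {R : ℝ} {f : ℕ → ℝ} (hf : IsConvexGrowth R f) (hR : 0 ≤ R)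
    {l q : ℝ} (hl : 0 ≤ l) (hq : 0 ≤ q) :
    ∑' k, poisWt l k * ∑' j, poisWt q j * f (k + j) = ∑' m, poisWt (l + q) m * f m := by
  obtain ⟨C, hC⟩ := hf.growth
  have hs : Summable fun x : ℕ × ℕ => poisWt l x.1 * (poisWt q x.2 * f (x.1 + x.2)) := by
    have h := ((summable_poisWt_mul_geom l R).mul_of_nonneg (summable_poisWt_mul_geom q R)
      (fun k => mul_nonneg (poisWt_nonneg hl k) (pow_nonneg hR k))
      (fun k => mul_nonneg (poisWt_nonneg hq k) (pow_nonneg hR k))).mul_left C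
    refine h.of_nonneg_of_le (fun x => mul_nonneg (poisWt_nonneg hl _)
      (mul_nonneg (poisWt_nonneg hq _) (hf.nonneg _))) fun x => ?_
    have h2 := mul_le_mul_of_nonneg_left (mul_le_mul_of_nonneg_left (hC (x.1 + x.2))
      (poisWt_nonneg hq x.2)) (poisWt_nonneg hl x.1)
    refine h2.trans_eq ?_
    rw [pow_add]; ring
  have e1 : ∑' k, poisWt l k * ∑' j, poisWt q j * f (k + j) =
      ∑' x : ℕ × ℕ, poisWt l x.1 * (poisWt q x.2 * f (x.1 + x.2)) := by
    rw [hs.tsum_prod]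
    simp only [tsum_mul_left]
  have hs2 := Finset.HasAntidiagonal.sigmaAntidiagonalEquivProd.summable_iff.2 hs
  rw [e1, ← Finset.HasAntidiagonal.sigmaAntidiagonalEquivProd.tsum_eq]
  refine (hs2.tsum_sigma' fun m => (hasSum_fintype _).summable).trans (tsum_congr fun m => ?_)
  rw [tsum_fintype, ← sum_antidiagonal_poisWt, Finset.sum_mul,
    ← Finset.sum_coe_sort (Finset.HasAntidiagonal.antidiagonal m)]
  refine Finset.sum_congr rfl fun x _ => ?_
  change poisWt l x.1.1 * (poisWt q x.1.2 * f (x.1.1 + x.1.2)) = _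
  rw [Finset.HasAntidiagonal.mem_antidiagonal.1 x.2]
  ring

/-- A sum of independent Bernoulli variables is smaller in the convex order than the Poisson law
with the same mean. -/
lemma bernExp_le_poisson {I : Type*} (s : Finset I) (p : I → ℝ) (h0 : ∀ i, 0 ≤ p i)
    (h1 : ∀ i, p i ≤ 1) {R : ℝ} (hR : 0 ≤ R) {f : ℕ → ℝ} (hf : IsConvexGrowth R f) :
    bernExp s p f ≤ ∑' k, poisWt (∑ i ∈ s, p i) k * f k := by
  classical
  -- The Poisson variable replacing the inserted Bernoulli variable is averaged into f.
  induction s using Finset.induction_on generalizing f with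
  | empty =>
    rw [bernExp_empty, Finset.sum_empty, tsum_eq_single 0]
    · simp [poisWt]
    · intro k hk
      simp [poisWt, hk]
  | insert a s ha ih =>
    rw [bernExp_insert p ha, Finset.sum_insert ha, add_comm (p a),
      ← hf.tsum_tsum hR (Finset.sum_nonneg fun i _ => h0 i) (h0 a)]
    refine le_trans ?_ (ih (hf.smooth (h0 a)))
    rw [← bernExp_const_mul, ← bernExp_const_mul, ← bernExp_add]
    exact bernExp_mono s p h0 h1 fun k => hf.bernoulli_le (h0 a) k

end ConvexOrder

/-! ### Entropy inequalities and H(W) ≤ H(Z). -/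

section Entropy

/-- The information `-log π_k` of the Poisson weights. -/
noncomputable def poisInfo (l : ℝ) (k : ℕ) : ℝ := l - k * Real.log l + Real.log k.factorial

lemma log_poisWt {l : ℝ} (hl : 0 < l) (k : ℕ) : Real.log (poisWt l k) = -poisInfo l k := by
  rw [poisWt, Real.log_div (by positivity) (by positivity),
    Real.log_mul (by positivity) (by positivity), Real.log_exp, Real.log_pow, poisInfo]
  ring

lemma negMulLog_poisWt {l : ℝ} (hl : 0 < l) (k : ℕ) :
    Real.negMulLog (poisWt l k) = poisWt l k * poisInfo l k := by
  rw [Real.negMulLog, log_poisWt hl]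
  ring

lemma isConvexGrowth_poisInfo {l : ℝ} (hl : 0 < l) :
    IsConvexGrowth (Real.exp 1) (poisInfo l) where
  nonneg k := by
    have := Real.log_nonpos (poisWt_nonneg hl.le k) (poisWt_le_one hl.le k)
    rw [log_poisWt hl] at this
    linarith
  convex k := by
    have h : ∀ k : ℕ, poisInfo l (k + 1) - poisInfo l k = Real.log (k + 1) - Real.log l := by
      intro k
      rw [poisInfo, poisInfo, Nat.factorial_succ]
      push_cast
      rw [Real.log_mul (by positivity) (by positivity)]
      ring
    rw [h, show k + 2 = k + 1 + 1 from rfl, h (k + 1)]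
    have : Real.log ((k : ℝ) + 1) ≤ Real.log ((k + 1 : ℕ) + 1) :=
      Real.log_le_log (by positivity) (by push_cast; linarith)
    linarith
  growth := by
    refine ⟨l + |Real.log l| + 2, fun k => ?_⟩
    rw [← Real.exp_nat_mul, mul_one]
    have h1 : (1 : ℝ) ≤ Real.exp k := Real.one_le_exp (Nat.cast_nonneg k)
    have h2 : (k : ℝ) ≤ Real.exp k := by linarith [Real.add_one_le_exp (k : ℝ)]
    have h3 : (k : ℝ) ^ 2 / 2 ≤ Real.exp k := by
      have := Real.pow_div_factorial_le_exp (x := (k : ℝ)) (Nat.cast_nonneg k) 2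
      simpa using this
    have h4 : Real.log k.factorial ≤ (k : ℝ) ^ 2 := by
      rcases Nat.eq_zero_or_pos k with rfl | hk
      · simp
      · have hk0 : (0 : ℝ) < k := by exact_mod_cast hk
        have := Real.log_le_log (by positivity)
          (by exact_mod_cast Nat.factorial_le_pow k : (k.factorial : ℝ) ≤ (k : ℝ) ^ k)
        rw [Real.log_pow] at this
        nlinarith [Real.log_le_sub_one_of_pos hk0]
    have h5 : -(k * Real.log l) ≤ |Real.log l| * Real.exp k := by
      calc -(k * Real.log l) = k * (-Real.log l) := by ring
        _ ≤ k * |Real.log l| := mul_le_mul_of_nonneg_left (neg_le_abs _) (Nat.cast_nonneg k)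
        _ ≤ _ := by rw [mul_comm]; exact mul_le_mul_of_nonneg_left h2 (abs_nonneg _)
    rw [poisInfo]
    nlinarith

lemma summable_negMulLog_poisWt {l : ℝ} (hl : 0 < l) :
    Summable fun k => Real.negMulLog (poisWt l k) := by
  have := (isConvexGrowth_poisInfo hl).summable hl.le 0
  simpa [negMulLog_poisWt hl] using this

/-- Gibbs' inequality term by term, from log x ≤ x - 1; equivalently the tangent to the concave
function -x log x at q. -/
lemma negMulLog_le_cross {w q : ℝ} (hw : 0 ≤ w) (hq : 0 < q) :
    Real.negMulLog w ≤ -(w * Real.log q) + (q - w) := by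
  rcases hw.eq_or_lt with rfl | hw
  · simp; exact hq.le
  · have h := Real.log_le_sub_one_of_pos (div_pos hq hw)
    rw [Real.log_div hq.ne' hw.ne'] at h
    have h2 := mul_le_mul_of_nonneg_left h hw.le
    have e : w * (q / w - 1) = q - w := by field_simp
    rw [e] at h2
    rw [Real.negMulLog]
    linarith

lemma sum_coeff_bernSer {I : Type*} (s : Finset I) (p : I → ℝ) :
    ∑ k ∈ Finset.range (s.card + 1), PowerSeries.coeff k (bernSer s p) = 1 := by
  have := bernExp_const s p 1
  simpa [bernExp] using this

lemma entropy_bernSer_le {I : Type*} (s : Finset I) (p : I → ℝ) (h0 : ∀ i, 0 ≤ p i)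
    (h1 : ∀ i, p i ≤ 1) {l : ℝ} (hl : l = ∑ i ∈ s, p i) (hl0 : 0 < l) :
    ∑ k ∈ Finset.range (s.card + 1), Real.negMulLog (PowerSeries.coeff k (bernSer s p)) ≤
      ∑' k, Real.negMulLog (poisWt l k) := by
  have h := bernExp_le_poisson s p h0 h1 (Real.exp_nonneg 1) (isConvexGrowth_poisInfo hl0)
  rw [← hl] at h
  simp only [← negMulLog_poisWt hl0] at h
  refine le_trans ?_ h
  -- The Bernoulli law has full mass on this range, so the Gibbs corrections π_k - w_k sum to at
  -- most 0.
  have h2 : ∑ k ∈ Finset.range (s.card + 1), poisWt l k ≤ 1 :=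
    sum_le_hasSum _ (fun k _ => poisWt_nonneg hl0.le k) (hasSum_poisWt l)
  have h3 := sum_coeff_bernSer s p
  calc _ ≤ ∑ k ∈ Finset.range (s.card + 1), (PowerSeries.coeff k (bernSer s p) * poisInfo l k +
        (poisWt l k - PowerSeries.coeff k (bernSer s p))) := by
        refine Finset.sum_le_sum fun k _ => ?_
        have := negMulLog_le_cross (coeff_bernSer_nonneg s p h0 h1 k) (poisWt_pos hl0 k)
        rw [log_poisWt hl0] at this
        linarith
    _ ≤ _ := by
        rw [Finset.sum_add_distrib, Finset.sum_sub_distrib, bernExp]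
        linarith

lemma negMulLog_add_le {a b : ℝ} (ha : 0 ≤ a) (hb : 0 ≤ b) :
    Real.negMulLog (a + b) ≤ Real.negMulLog a + Real.negMulLog b := by
  rcases ha.eq_or_lt with rfl | ha
  · simp
  rcases hb.eq_or_lt with rfl | hb
  · simp
  simp only [Real.negMulLog]
  have h1 := Real.log_le_log ha (by linarith : a ≤ a + b)
  have h2 := Real.log_le_log hb (by linarith : b ≤ a + b)
  nlinarith

/-- Splitting w into c and w - c, Gibbs against w(1 - d) and wd bounds the sum of the two terms by
φ(w) - c log(1 - d) - (w - c) log d. As w - c ≤ d, the term of w - c is at least the last summand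
and cancels it. -/
lemma negMulLog_le_of_sub_le {c w d : ℝ} (hc : 0 ≤ c) (hcw : c ≤ w) (hw : w ≤ 1) (hd : w - c ≤ d)
    (hcd : c ≤ 1 - d) :
    Real.negMulLog c ≤ Real.negMulLog w - c * Real.log (1 - d) := by
  rcases hc.eq_or_lt with rfl | hc
  · simp; exact Real.negMulLog_nonneg hcw hw
  have hw0 : 0 < w := hc.trans_le hcw
  have hd1 : 0 < 1 - d := hc.trans_le hcd
  have h1 := negMulLog_le_cross hc.le (mul_pos hw0 hd1)
  rw [Real.log_mul hw0.ne' hd1.ne'] at h1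
  rcases (sub_nonneg.2 hcw).eq_or_lt with h | h
  · have : c = w := by linarith
    subst this
    have : Real.log (1 - d) ≤ 0 := Real.log_nonpos hd1.le (by linarith)
    nlinarith
  · have hd0 : 0 < d := h.trans_le hd
    have h2 := negMulLog_le_cross h.le (mul_pos hw0 hd0)
    rw [Real.log_mul hw0.ne' hd0.ne'] at h2
    have h3 := Real.log_le_log h hd
    simp only [Real.negMulLog] at h1 h2 ⊢
    have h4 := mul_le_mul_of_nonneg_left h3 h.le
    nlinarith

lemma negMulLog_sub_le {d t : ℝ} (ht : 0 ≤ t) (htd : t ≤ d) (hd : d ≤ 1) :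
    Real.negMulLog (d - t) ≤ Real.negMulLog d + t := by
  rcases (ht.trans htd).eq_or_lt with rfl | hd0
  · have : t = 0 := le_antisymm htd ht
    subst this; simp
  have h := negMulLog_le_cross (sub_nonneg.2 htd) hd0
  have h2 := mul_nonneg ht (neg_nonneg.2 (Real.log_nonpos hd0.le hd))
  rw [Real.negMulLog_def] at h ⊢
  simp only at h ⊢
  nlinarith

/-- At most m - 1 masses are nonzero, so the uniform distribution on m - 1 points is the extremal
one. -/
lemma sum_negMulLog_le {m : ℕ} (hm : 2 ≤ m) {α : ℕ → ℝ} (hα : ∀ k, 0 ≤ α k)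
    (h0 : ∃ k < m, α k = 0) :
    ∑ k ∈ Finset.range m, Real.negMulLog (α k) ≤
      Real.negMulLog (∑ k ∈ Finset.range m, α k) +
        (∑ k ∈ Finset.range m, α k) * Real.log ((m : ℝ) - 1) := by
  obtain ⟨k₀, hk₀, hk₀'⟩ := h0
  have hm1 : (0 : ℝ) < (m : ℝ) - 1 := by
    have : (2 : ℝ) ≤ m := by exact_mod_cast hm
    linarith
  set a := ∑ k ∈ Finset.range m, α k with ha
  have hmem : k₀ ∈ Finset.range m := Finset.mem_range.2 hk₀
  have ha' : ∑ k ∈ (Finset.range m).erase k₀, α k = a := by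
    rw [ha, ← Finset.add_sum_erase _ _ hmem, hk₀', zero_add]
  rw [← Finset.add_sum_erase _ _ hmem, hk₀', Real.negMulLog_zero, zero_add]
  rcases (Finset.sum_nonneg fun k _ => hα k : 0 ≤ a).eq_or_lt with h | h
  · have h' : a = 0 := h.symm
    rw [h']
    have : ∀ k ∈ Finset.range m, α k = 0 :=
      (Finset.sum_eq_zero_iff_of_nonneg fun k _ => hα k).1 h'
    rw [Finset.sum_eq_zero fun k hk => by
      rw [this k (Finset.mem_of_mem_erase hk), Real.negMulLog_zero]]
    simp
  · have hq : 0 < a / ((m : ℝ) - 1) := div_pos h hm1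
    calc _ ≤ ∑ k ∈ (Finset.range m).erase k₀,
          (-(α k * Real.log (a / ((m : ℝ) - 1))) + (a / ((m : ℝ) - 1) - α k)) :=
          Finset.sum_le_sum fun k _ => negMulLog_le_cross (hα k) hq
      _ = _ := by
          rw [Finset.sum_add_distrib, Finset.sum_neg_distrib, ← Finset.sum_mul,
            Finset.sum_sub_distrib, ha', Finset.sum_const, Finset.card_erase_of_mem hmem,
            Finset.card_range, nsmul_eq_mul, Nat.cast_sub (by omega), Nat.cast_one,
            mul_div_cancel₀ _ hm1.ne', Real.log_div h.ne' hm1.ne', Real.negMulLog]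
          ring

end Entropy

/-! ### Total variation distance and the entropy difference. -/

section Coupling

variable {I : Type*}

/-- The total variation distance between the law of a sum of independent Bernoulli variables and
the Poisson law with mean `l`. -/
noncomputable def bernTV (s : Finset I) (p : I → ℝ) (l : ℝ) : ℝ :=
  ∑ k ∈ Finset.range (s.card + 1), max (PowerSeries.coeff k (bernSer s p) - poisWt l k) 0

lemma bernTV_nonneg (s : Finset I) (p : I → ℝ) (l : ℝ) : 0 ≤ bernTV s p l :=
  Finset.sum_nonneg fun _ _ => le_max_right _ _

lemma sum_range_coeff_bernSer (s : Finset I) (p : I → ℝ) {m : ℕ} (hm : s.card < m) :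
    ∑ k ∈ Finset.range m, PowerSeries.coeff k (bernSer s p) = 1 := by
  have := bernExp_eq_sum_range s p (fun _ => 1) hm
  rw [bernExp_const] at this
  simpa using this.symm

lemma bernTV_eq_sum_range (s : Finset I) (p : I → ℝ) {l : ℝ} (hl : 0 ≤ l) {m : ℕ}
    (hm : s.card < m) :
    bernTV s p l =
      ∑ k ∈ Finset.range m, max (PowerSeries.coeff k (bernSer s p) - poisWt l k) 0 := by
  refine Finset.sum_subset (Finset.range_mono hm) fun k _ hk => ?_
  rw [Finset.mem_range, not_lt] at hk
  rw [coeff_bernSer_eq_zero s p hk, zero_sub, max_eq_right]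
  exact neg_nonpos.2 (poisWt_nonneg hl k)

/-- Both laws exceed each other by the same total mass; beyond the support of W the Poisson excess
is the whole tail. -/
lemma sum_range_max_poisWt_sub (s : Finset I) (p : I → ℝ) {l : ℝ} (hl : 0 ≤ l) {m : ℕ}
    (hm : s.card < m) :
    ∑ k ∈ Finset.range m, max (poisWt l k - PowerSeries.coeff k (bernSer s p)) 0 =
      bernTV s p l - poisTail l m := by
  have h1 := sum_range_coeff_bernSer s p hm
  have h2 := sum_range_add_poisTail l m
  rw [bernTV_eq_sum_range s p hl hm]
  have e : ∀ a b : ℝ, max (a - b) 0 = max (b - a) 0 + (a - b) := by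
    intro a b
    rcases le_total a b with h | h
    · rw [max_eq_right (by linarith), max_eq_left (by linarith)]; ring
    · rw [max_eq_left (by linarith), max_eq_right (by linarith)]; ring
  rw [Finset.sum_congr rfl fun k _ => e (poisWt l k) _, Finset.sum_add_distrib,
    Finset.sum_sub_distrib]
  linarith

lemma bernTV_le_barbour_hall (s : Finset I) (p : I → ℝ) (h0 : ∀ i, 0 ≤ p i)
    (h1 : ∀ i, p i ≤ 1) {l θ : ℝ} (hl : l = ∑ i ∈ s, p i) (hl0 : 0 < l)
    (hθ : θ = (∑ i ∈ s, p i ^ 2) / l) : bernTV s p l ≤ θ * (1 - Real.exp (-l)) := by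
  classical
  set A := (Finset.range (s.card + 1)).filter
    fun k => poisWt l k < PowerSeries.coeff k (bernSer s p) with hA
  refine le_trans (le_of_eq ?_)
    (sum_bernSer_sub_poisWt_le s p h0 h1 hl hl0 hθ A (Finset.filter_subset _ _))
  rw [hA, Finset.sum_filter, bernTV]
  refine Finset.sum_congr rfl fun k _ => ?_
  split_ifs with h
  · exact max_eq_left (by linarith)
  · exact max_eq_right (by linarith)

lemma bernTV_le_roos (s : Finset I) (p : I → ℝ) {l θ : ℝ} (hl : l = ∑ i ∈ s, p i) (hl0 : 0 < l)
    (hq : 0 < ∑ i ∈ s, p i ^ 2) (hθ : θ = (∑ i ∈ s, p i ^ 2) / l)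
    (hθ1 : Real.sqrt θ ≤ 0.577) :
    bernTV s p l ≤ θ * (3 / (4 * Real.exp 1 * (1 - Real.sqrt θ) ^ (3 / 2 : ℝ))) := by
  set B := θ * (3 / (4 * Real.exp 1 * (1 - Real.sqrt θ) ^ (3 / 2 : ℝ)))
  have h : ∀ m, s.card < m → 2 * bernTV s p l - poisTail l m ≤ 2 * B := by
    intro m hm
    have h1 := sum_abs_bernSer_sub_poisWt_le s p hl hl0 hq hθ hθ1 (Finset.range m)
    have h2 := sum_range_max_poisWt_sub s p hl0.le hm
    have h3 := bernTV_eq_sum_range s p hl0.le hm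
    have e : ∀ a b : ℝ, |a - b| = max (a - b) 0 + max (b - a) 0 := by
      intro a b
      rcases le_total a b with h | h
      · rw [max_eq_right (by linarith), max_eq_left (by linarith), abs_of_nonpos (by linarith)]
        ring
      · rw [max_eq_left (by linarith), max_eq_right (by linarith), abs_of_nonneg (by linarith)]
        ring
    rw [Finset.sum_congr rfl fun k _ => e _ (poisWt l k), Finset.sum_add_distrib, ← h3, h2] at h1
    linarith
  have ht : Filter.Tendsto (fun m => 2 * bernTV s p l - poisTail l m) Filter.atTop
      (nhds (2 * bernTV s p l - 0)) :=
    tendsto_const_nhds.sub (tendsto_sum_nat_add (poisWt l))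
  have := le_of_tendsto ht (Filter.eventually_atTop.2 ⟨s.card + 1, fun m hm => h m (by omega)⟩)
  linarith

/-- The factor reaches 1 slightly below x = 0.577. Beyond this threshold the Stein bound is already
the better one, so Roos' bound is needed only for √θ ≤ 0.577. -/
lemma one_le_roos_factor {x : ℝ} (h0 : 0.577 ≤ x) (h1 : x < 1) :
    1 ≤ 3 / (4 * Real.exp 1 * (1 - x) ^ (3 / 2 : ℝ)) := by
  have hx : 0 < 1 - x := by linarith
  set S := (1 - x) ^ (3 / 2 : ℝ) with hS
  have hS0 : 0 < S := Real.rpow_pos_of_pos hx _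
  have hS2 : S ^ 2 = (1 - x) ^ 3 := by
    rw [hS, ← Real.rpow_natCast, ← Real.rpow_mul hx.le, ← Real.rpow_natCast]
    norm_num
  have h2 : (1 - x) ^ 3 ≤ 0.423 ^ 3 := pow_le_pow_left₀ hx.le (by linarith) 3
  have h3 : S ≤ 0.2759 := by
    apply le_of_sq_le_sq _ (by norm_num)
    rw [hS2]
    refine h2.trans (by norm_num)
  rw [le_div_iff₀ (by positivity)]
  have := Real.exp_one_lt_d9
  nlinarith

lemma bernTV_le_etaParam (s : Finset I) (p : I → ℝ) (h0 : ∀ i, 0 ≤ p i) (h1 : ∀ i, p i ≤ 1)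
    {l θ : ℝ} (hl : l = ∑ i ∈ s, p i) (hl0 : 0 < l) (hq : 0 < ∑ i ∈ s, p i ^ 2)
    (hθ : θ = (∑ i ∈ s, p i ^ 2) / l) (hθ1 : θ ≤ 1) : bernTV s p l ≤ etaParam l θ := by
  have hbh := bernTV_le_barbour_hall s p h0 h1 hl hl0 hθ
  rw [etaParam]
  split_ifs with h
  · exact hbh
  have hlt : θ < 1 := lt_of_le_of_ne hθ1 h
  have hθ0 : 0 < θ := by rw [hθ]; positivity
  have hx1 : Real.sqrt θ < 1 := by rw [Real.sqrt_lt' one_pos]; simpa using hlt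
  rw [mul_min_of_nonneg _ _ hθ0.le]
  refine le_min hbh ?_
  rcases le_total (Real.sqrt θ) 0.577 with hx | hx
  · exact bernTV_le_roos s p hl hl0 hq hθ hx
  · refine hbh.trans (mul_le_mul_of_nonneg_left ?_ hθ0.le)
    have := one_le_roos_factor hx hx1
    linarith [Real.exp_pos (-l)]

/-- The entropy of the Poisson law exceeds the entropy of a Bernoulli sum by at most the
conditional entropy under a maximal coupling. -/
lemma entropy_sub_le (s : Finset I) (p : I → ℝ) (h0 : ∀ i, 0 ≤ p i) (h1 : ∀ i, p i ≤ 1)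
    {l : ℝ} (hl0 : 0 < l) {m : ℕ} (hm : s.card < m) (hm2 : 2 ≤ m) :
    ∑' k, Real.negMulLog (poisWt l k) -
      ∑ k ∈ Finset.range (s.card + 1), Real.negMulLog (PowerSeries.coeff k (bernSer s p)) ≤
    Real.binEntropy (bernTV s p l) + (bernTV s p l - poisTail l m) * Real.log ((m : ℝ) - 1) +
      poisTail l m + ∑' k, Real.negMulLog (poisWt l (k + m)) := by
  set w := fun k => PowerSeries.coeff k (bernSer s p) with hw
  set d := bernTV s p l with hd
  set α := fun k => max (poisWt l k - w k) 0 with hα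
  set β := fun k => max (w k - poisWt l k) 0 with hβ
  have hw0 : ∀ k, 0 ≤ w k := coeff_bernSer_nonneg s p h0 h1
  have hws : ∑ k ∈ Finset.range m, w k = 1 := sum_range_coeff_bernSer s p hm
  have hβs : ∑ k ∈ Finset.range m, β k = d := (bernTV_eq_sum_range s p hl0.le hm).symm
  have hαs : ∑ k ∈ Finset.range m, α k = d - poisTail l m :=
    sum_range_max_poisWt_sub s p hl0.le hm
  have hα0 : ∀ k, 0 ≤ α k := fun k => le_max_right _ _
  have hβ0 : ∀ k, 0 ≤ β k := fun k => le_max_right _ _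
  have hβw : ∀ k, β k ≤ w k := fun k =>
    max_le (by linarith [poisWt_nonneg hl0.le k]) (hw0 k)
  have hπ : ∀ k, poisWt l k = (w k - β k) + α k := by
    intro k
    simp only [hα, hβ]
    rcases le_total (w k) (poisWt l k) with h | h
    · rw [max_eq_left (sub_nonneg.2 h), max_eq_right (sub_nonpos.2 h)]; ring
    · rw [max_eq_right (sub_nonpos.2 h), max_eq_left (sub_nonneg.2 h)]; ring
  have hT : poisTail l m ≤ d := by
    have : 0 ≤ ∑ k ∈ Finset.range m, α k := Finset.sum_nonneg fun k _ => hα0 k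
    linarith
  have hd1 : d ≤ 1 := by
    rw [← hβs, ← hws]
    exact Finset.sum_le_sum fun k _ => hβw k
  have hcs : ∑ k ∈ Finset.range m, (w k - β k) = 1 - d := by
    rw [Finset.sum_sub_distrib, hws, hβs]
  -- The Poisson weights cannot exceed w everywhere below m, where w already has mass 1.
  have hαz : ∃ k < m, α k = 0 := by
    by_contra! hne
    have : ∑ k ∈ Finset.range m, w k < ∑ k ∈ Finset.range m, poisWt l k := by
      refine Finset.sum_lt_sum_of_nonempty ⟨0, Finset.mem_range.2 (by omega)⟩ fun k hk => ?_
      by_contra! h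
      exact hne k (Finset.mem_range.1 hk) (max_eq_right (sub_nonpos.2 h))
    have h2 := sum_range_add_poisTail l m
    have h3 := poisTail_nonneg hl0.le m
    linarith
  have hsplit := (summable_negMulLog_poisWt hl0).sum_add_tsum_nat_add m
  have hA := sum_negMulLog_le hm2 hα0 hαz
  rw [hαs] at hA
  have hB := negMulLog_sub_le (poisTail_nonneg hl0.le m) hT hd1
  have hC : ∑ k ∈ Finset.range m, Real.negMulLog (w k - β k) ≤
      ∑ k ∈ Finset.range m, Real.negMulLog (w k) + Real.negMulLog (1 - d) := by
    have : ∀ k ∈ Finset.range m, Real.negMulLog (w k - β k) ≤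
        Real.negMulLog (w k) - (w k - β k) * Real.log (1 - d) := by
      intro k hk
      refine negMulLog_le_of_sub_le (sub_nonneg.2 (hβw k)) (by linarith [hβ0 k]) ?_ ?_ ?_
      · rw [← hws]; exact Finset.single_le_sum (fun k _ => hw0 k) hk
      · rw [sub_sub_cancel, ← hβs]; exact Finset.single_le_sum (fun k _ => hβ0 k) hk
      · rw [← hcs]
        exact Finset.single_le_sum (f := fun k => w k - β k)
          (fun k _ => sub_nonneg.2 (hβw k)) hk
    refine (Finset.sum_le_sum this).trans_eq ?_
    rw [Finset.sum_sub_distrib, ← Finset.sum_mul, hcs, Real.negMulLog]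
    ring
  have hD : ∑ k ∈ Finset.range m, Real.negMulLog (poisWt l k) ≤
      ∑ k ∈ Finset.range m, Real.negMulLog (w k - β k) +
        ∑ k ∈ Finset.range m, Real.negMulLog (α k) := by
    rw [← Finset.sum_add_distrib]
    refine Finset.sum_le_sum fun k _ => ?_
    rw [hπ k]
    exact negMulLog_add_le (sub_nonneg.2 (hβw k)) (hα0 k)
  have hE : ∑ k ∈ Finset.range (s.card + 1), Real.negMulLog (w k) =
      ∑ k ∈ Finset.range m, Real.negMulLog (w k) := by
    refine Finset.sum_subset (Finset.range_mono hm) fun k _ hk => ?_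
    rw [Finset.mem_range, not_lt] at hk
    simp only [hw]
    rw [coeff_bernSer_eq_zero s p hk, Real.negMulLog_zero]
  rw [hE, Real.binEntropy_eq_negMulLog_add_negMulLog_one_sub]
  linarith

/-- The concave function h(x) + x log(M - 1) peaks at 1 - 1/M, and `hM` places η at or before that
point. The proof uses the tangent at η, whose slope is nonnegative. -/
lemma binEntropy_add_mul_log_mono {d η M : ℝ} (hd : 0 ≤ d) (hdη : d ≤ η) (hη0 : 0 < η) (hη1 : η < 1)
    (hM : 1 ≤ M * (1 - η)) :
    Real.binEntropy d + d * Real.log (M - 1) ≤ Real.binEntropy η + η * Real.log (M - 1) := by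
  have hη1' : 0 < 1 - η := by linarith
  have h1 := negMulLog_le_cross hd hη0
  have h2 := negMulLog_le_cross (w := 1 - d) (by linarith) hη1'
  have h3 : Real.log η ≤ Real.log (M - 1) + Real.log (1 - η) := by
    have hM1 : 0 < (M - 1) * (1 - η) := by linarith
    have hM2 : 0 < M - 1 := pos_of_mul_pos_left hM1 hη1'.le
    rw [← Real.log_mul hM2.ne' hη1'.ne']
    exact Real.log_le_log hη0 (by linarith)
  rw [Real.binEntropy_eq_negMulLog_add_negMulLog_one_sub,
    Real.binEntropy_eq_negMulLog_add_negMulLog_one_sub]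
  have h4 : Real.negMulLog η = -(η * Real.log η) := by rw [Real.negMulLog]; ring
  have h5 : Real.negMulLog (1 - η) = -((1 - η) * Real.log (1 - η)) := by rw [Real.negMulLog]; ring
  rw [h4, h5]
  nlinarith [mul_nonneg (sub_nonneg.2 hdη) (sub_nonneg.2 h3)]

end Coupling

/-! ### Entropy of the Poisson tail. -/

section TailEntropy

lemma poisInfo_le {l : ℝ} {k : ℕ} (hk : k ≠ 0) :
    poisInfo l k ≤ l - (1 + Real.log l) * k + k * Real.log k + Real.log k / 2 +
      (6 * Real.log (2 * Real.pi) + 1) / 12 := by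
  have := log_factorial_le_stirling hk
  rw [poisInfo]
  linarith

lemma add_half_mul_log_le {x : ℝ} (hx : 3 ≤ x) :
    x * Real.log x + Real.log x / 2 + 1 ≤ x * (x - 1) := by
  have hx0 : 0 < x := by linarith
  have he := Real.exp_one_gt_d9
  have h := Real.log_le_sub_one_of_pos (div_pos hx0 (Real.exp_pos 1))
  rw [Real.log_div hx0.ne' (Real.exp_pos 1).ne', Real.log_exp] at h
  have h2 : x / Real.exp 1 ≤ 0.368 * x := by
    rw [div_le_iff₀ (Real.exp_pos 1)]; nlinarith
  have h3 : Real.log x ≤ 0.368 * x := by linarith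
  have h4 := mul_le_mul_of_nonneg_left h3 hx0.le
  nlinarith

lemma stirling_const_nonneg : 0 ≤ (6 * Real.log (2 * Real.pi) + 1) / 12 := by
  have : 0 ≤ Real.log (2 * Real.pi) := Real.log_nonneg (by linarith [Real.pi_gt_three])
  positivity

lemma mul_log_exp_div {l : ℝ} (hl : 0 < l) :
    l * Real.log (Real.exp 1 / l) = l * (1 - Real.log l) := by
  rw [Real.log_div (Real.exp_pos 1).ne' hl.ne', Real.log_exp]

/-- For the case M = n + 2. A majorant of -log π_j in the basis 1, j, j(j - 1) is summed with the
truncated factorial moments. The 1 saved in `add_half_mul_log_le` pays for the additional tail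
probability. -/
lemma tail_entropy_add_tail_le {l B : ℝ} (hl : 0 < l) {n : ℕ} (hn : n ≠ 0)
    (hB : poisTail l n ≤ B) :
    poisTail l (n + 2) + ∑' k, Real.negMulLog (poisWt l (k + (n + 2))) ≤
      (max (l * Real.log (Real.exp 1 / l)) 0 + l ^ 2 +
        (6 * Real.log (2 * Real.pi) + 1) / 12) * B := by
  set K := (6 * Real.log (2 * Real.pi) + 1) / 12 with hK
  have hK0 : 0 ≤ K := stirling_const_nonneg
  have s0 := (summable_poisWt_add l (n + 2)).hasSum
  change HasSum _ (poisTail l (n + 2)) at s0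
  have s1 := hasSum_mul_poisWt_add l (n + 1)
  have s2 := hasSum_mul_mul_poisWt_add l n
  have s := ((s0.mul_left (l + K - 1)).sub (s1.mul_left (1 + Real.log l))).add s2
  have hle : ∑' k, Real.negMulLog (poisWt l (k + (n + 2))) ≤
      (l + K - 1) * poisTail l (n + 2) - (1 + Real.log l) * (l * poisTail l (n + 1)) +
        l ^ 2 * poisTail l n := by
    rw [← s.tsum_eq]
    refine ((summable_nat_add_iff (n + 2)).2 (summable_negMulLog_poisWt hl)).tsum_le_tsum
      (fun k => ?_) s.summable
    set j := k + (n + 2) with hj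
    have hj3 : (3 : ℝ) ≤ j := by exact_mod_cast (by omega : 3 ≤ j)
    have h1 := poisInfo_le (l := l) (show j ≠ 0 by omega)
    have h2 := add_half_mul_log_le hj3
    rw [negMulLog_poisWt hl]
    have h3 : poisInfo l j ≤ (l + K - 1) - (1 + Real.log l) * j + j * (j - 1) := by linarith
    refine (mul_le_mul_of_nonneg_left h3 (poisWt_nonneg hl.le j)).trans_eq ?_
    ring
  have t1 : poisTail l (n + 1) ≤ poisTail l n := poisTail_antitone hl.le (Nat.le_succ n)
  have t2 : poisTail l (n + 2) ≤ poisTail l (n + 1) := poisTail_antitone hl.le (Nat.le_succ _)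
  have t0 := poisTail_nonneg hl.le (n + 1)
  have hB0 : 0 ≤ B := t0.trans (t1.trans hB)
  have hmax : -(l * Real.log l) * poisTail l (n + 1) ≤
      max (l * Real.log (Real.exp 1 / l)) 0 * B := by
    have h1 : -(l * Real.log l) ≤ max (l * Real.log (Real.exp 1 / l)) 0 := by
      refine le_trans ?_ (le_max_left _ _)
      rw [mul_log_exp_div hl]; linarith
    exact (mul_le_mul_of_nonneg_right h1 t0).trans
      (mul_le_mul_of_nonneg_left (t1.trans hB) (le_max_right _ _))
  have h3 := mul_le_mul_of_nonneg_left hB (sq_nonneg l)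
  have h4 := mul_le_mul_of_nonneg_left (t2.trans (t1.trans hB)) hK0
  have h5 := mul_le_mul_of_nonneg_left t2 hl.le
  linarith

/-- For the case M = 1/(1 - η), where n + 2 stands for ⌊M⌋ and Chernoff at M - 2 controls only the
tail from n + 1. The tangent to log at n + 2, with log(n + 2) ≤ l, gives the quadratic term the
small coefficient 1/(n + 2). The leftover l π_{n+1} from the tail at n then cancels against l times
the tail from n + 2. -/
lemma tail_entropy_le {l B : ℝ} (hl : 0 < l) {n : ℕ} (hn : l ≤ (n : ℝ) + 1)
    (hlog : Real.log ((n : ℝ) + 2) ≤ l) (hB : poisTail l (n + 1) ≤ B) :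
    ∑' k, Real.negMulLog (poisWt l (k + (n + 2))) ≤
      (max (l * Real.log (Real.exp 1 / l)) 0 + l ^ 2 +
        (6 * Real.log (2 * Real.pi) + 1) / 12) * B := by
  set K := (6 * Real.log (2 * Real.pi) + 1) / 12 with hK
  have hK0 : 0 ≤ K := stirling_const_nonneg
  have s0 := (summable_poisWt_add l (n + 2)).hasSum
  change HasSum _ (poisTail l (n + 2)) at s0
  have s1 := hasSum_mul_poisWt_add l (n + 1)
  have s2 := hasSum_mul_mul_poisWt_add l n
  have hn2 : (0 : ℝ) < (n : ℝ) + 2 := by positivity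
  have s := ((s0.mul_left (l + K)).add (s1.mul_left
    (l - Real.log l - ((n : ℝ) + 1) / (n + 2)))).add (s2.mul_left (1 / ((n : ℝ) + 2)))
  have hle : ∑' k, Real.negMulLog (poisWt l (k + (n + 2))) ≤
      (l + K) * poisTail l (n + 2) + (l - Real.log l - ((n : ℝ) + 1) / (n + 2)) *
        (l * poisTail l (n + 1)) + 1 / ((n : ℝ) + 2) * (l ^ 2 * poisTail l n) := by
    rw [← s.tsum_eq]
    refine ((summable_nat_add_iff (n + 2)).2 (summable_negMulLog_poisWt hl)).tsum_le_tsum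
      (fun k => ?_) s.summable
    set j := k + (n + 2) with hj
    have hj0 : (0 : ℝ) < j := by exact_mod_cast (by omega : 0 < j)
    have h1 := poisInfo_le (l := l) (show j ≠ 0 by omega)
    have h2 : Real.log j ≤ l + (j / (n + 2) - 1) := by
      have := Real.log_le_sub_one_of_pos (div_pos hj0 hn2)
      rw [Real.log_div hj0.ne' hn2.ne'] at this
      linarith
    have h2' := mul_le_mul_of_nonneg_left h2 hj0.le
    have h2'' : Real.log j / 2 ≤ j := by linarith [Real.log_le_sub_one_of_pos hj0]
    rw [negMulLog_poisWt hl]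
    have h3 : poisInfo l j ≤ (l + K) + (l - Real.log l - ((n : ℝ) + 1) / (n + 2)) * j +
        1 / ((n : ℝ) + 2) * (j * (j - 1)) := by
      have e : (l + K) + (l - Real.log l - ((n : ℝ) + 1) / (n + 2)) * j +
        1 / ((n : ℝ) + 2) * (j * (j - 1)) = l + K - (1 + Real.log l) * j +
          j * (l + (j / (n + 2) - 1)) + j := by
        field_simp; ring
      rw [e]
      linarith
    refine (mul_le_mul_of_nonneg_left h3 (poisWt_nonneg hl.le j)).trans_eq ?_
    ring
  have t2 : poisTail l (n + 2) ≤ poisTail l (n + 1) := poisTail_antitone hl.le (Nat.le_succ _)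
  have t0 := poisTail_nonneg hl.le (n + 1)
  have hB0 : 0 ≤ B := t0.trans hB
  have e0 := poisTail_eq_add l n
  have e1 := poisTail_eq_add l (n + 1)
  have es := succ_mul_poisWt_succ l n
  have hs0 := poisWt_nonneg hl.le (n + 1)
  have hquad : 1 / ((n : ℝ) + 2) * (l ^ 2 * poisTail l n) - ((n : ℝ) + 1) / (n + 2) *
      (l * poisTail l (n + 1)) ≤ l * poisWt l (n + 1) := by
    have e : 1 / ((n : ℝ) + 2) * (l ^ 2 * poisTail l n) - ((n : ℝ) + 1) / (n + 2) *
      (l * poisTail l (n + 1)) = (l * ((n + 1) * poisWt l (n + 1)) -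
        (n + 1 - l) * (l * poisTail l (n + 1))) / (n + 2) := by
      rw [e0, es]; field_simp; ring
    rw [e, div_le_iff₀ hn2]
    have := mul_nonneg (sub_nonneg.2 hn) (mul_nonneg hl.le t0)
    nlinarith [mul_nonneg hl.le hs0]
  have hmax : (l * (1 - Real.log l)) * poisTail l (n + 1) ≤
      max (l * Real.log (Real.exp 1 / l)) 0 * B := by
    have h1 : l * (1 - Real.log l) ≤ max (l * Real.log (Real.exp 1 / l)) 0 := by
      rw [mul_log_exp_div hl]
      exact le_max_left _ _
    exact (mul_le_mul_of_nonneg_right h1 t0).trans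
      (mul_le_mul_of_nonneg_left hB (le_max_right _ _))
  have h3 := mul_le_mul_of_nonneg_left hB (sq_nonneg l)
  have h4 := mul_le_mul_of_nonneg_left (t2.trans hB) hK0
  have h5 := mul_nonneg hl.le t0
  have h6 : l * poisTail l (n + 2) = l * poisTail l (n + 1) - l * poisWt l (n + 1) := by
    rw [e1]; ring
  linarith

end TailEntropy

/-! ### Identification of the laws of W and Z. -/

section Law

lemma measureReal_sum_eq_coeff {I Ω : Type*} [MeasurableSpace Ω] (P : Measure Ω)
    [IsProbabilityMeasure P] (p : I → ℝ) (X : I → Ω → ℕ) (hX : ∀ α, Measurable (X α))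
    (hX1 : ∀ α, P.real {ω | X α ω = 1} = p α) (hX0 : ∀ α, P.real {ω | X α ω = 0} = 1 - p α)
    (hindep : iIndepFun X P) (s : Finset I) (k : ℕ) :
    P.real {ω | ∑ i ∈ s, X i ω = k} = PowerSeries.coeff k (bernSer s p) := by
  classical
  -- The variables take values in ℕ; the probabilities of 0 and 1 add up to 1, so other values are
  -- null.
  have hae : ∀ a, ∀ᵐ ω ∂P, X a ω = 0 ∨ X a ω = 1 := by
    intro a
    have hm0 : MeasurableSet {ω | X a ω = 0} := hX a (measurableSet_singleton 0)
    have hm1 : MeasurableSet {ω | X a ω = 1} := hX a (measurableSet_singleton 1)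
    have hd : Disjoint {ω | X a ω = 0} {ω | X a ω = 1} := by
      rw [Set.disjoint_left]
      intro ω h0 h1
      have h0' : X a ω = 0 := h0
      have h1' : X a ω = 1 := h1
      omega
    have h : P.real ({ω | X a ω = 0} ∪ {ω | X a ω = 1}) = 1 := by
      rw [measureReal_union hd hm1, hX0, hX1]
      ring
    have h2 : P ({ω | X a ω = 0} ∪ {ω | X a ω = 1}) = 1 := by
      rw [measureReal_def] at h
      rwa [← ENNReal.toReal_eq_one_iff]
    exact (mem_ae_iff_prob_eq_one (hm0.union hm1)).2 h2
  induction s using Finset.induction_on generalizing k with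
  | empty =>
    rw [coeff_bernSer_empty]
    rcases k with _ | k <;> simp
  | insert a s ha ih =>
    have hind : IndepFun (fun ω => ∑ i ∈ s, X i ω) (X a) P := by
      have := hindep.indepFun_finsetSum_of_notMem hX ha
      convert this using 1
      ext ω
      simp
    have hprod : ∀ i j : ℕ, P.real {ω | ∑ i ∈ s, X i ω = i ∧ X a ω = j} =
        P.real {ω | ∑ i ∈ s, X i ω = i} * P.real {ω | X a ω = j} := by
      intro i j
      have := hind.measure_inter_preimage_eq_mul {i} {j} (measurableSet_singleton i)
        (measurableSet_singleton j)
      rw [measureReal_def, measureReal_def, measureReal_def, ← ENNReal.toReal_mul]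
      exact congrArg ENNReal.toReal this
    have hsum : ∀ ω, ∑ i ∈ insert a s, X i ω = X a ω + ∑ i ∈ s, X i ω := fun ω =>
      Finset.sum_insert ha
    simp only [hsum]
    rcases k with _ | k
    · rw [coeff_zero_bernSer_insert p ha, ← ih, ← hX0, mul_comm, ← hprod]
      congr 1
      ext ω
      constructor
      · intro h
        have h' : X a ω + ∑ i ∈ s, X i ω = 0 := h
        exact ⟨by omega, by omega⟩
      · rintro ⟨h1, h2⟩
        change X a ω + ∑ i ∈ s, X i ω = 0
        omega
    · rw [coeff_succ_bernSer_insert p ha, ← ih, ← ih, ← hX0, ← hX1 a, mul_comm, ← hprod,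
        mul_comm (P.real {ω | X a ω = 1}), ← hprod]
      have hmS : Measurable fun ω => ∑ i ∈ s, X i ω :=
        Finset.measurable_fun_sum s fun i _ => hX i
      have hm : MeasurableSet {ω | ∑ i ∈ s, X i ω = k ∧ X a ω = 1} :=
        (hmS (measurableSet_singleton k)).inter (hX a (measurableSet_singleton 1))
      rw [← measureReal_union _ hm]
      · apply measureReal_congr
        filter_upwards [hae a] with ω hω
        apply propext
        change (X a ω + ∑ i ∈ s, X i ω = k + 1) ↔
          ((∑ i ∈ s, X i ω = k + 1 ∧ X a ω = 0) ∨ (∑ i ∈ s, X i ω = k ∧ X a ω = 1))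
        omega
      · rw [Set.disjoint_left]
        rintro ω ⟨_, h1⟩ ⟨_, h2⟩
        omega

lemma measureReal_eq_poisWt {Ω' : Type*} [MeasurableSpace Ω'] (Q : Measure Ω')
    {l : ℝ} (hl : 0 ≤ l) (Z : Ω' → ℕ) (hZ : HasLaw Z (poissonMeasure l.toNNReal) Q) (k : ℕ) :
    Q.real {ω | Z ω = k} = poisWt l k := by
  have h : (Q.map Z) {k} = Q {ω | Z ω = k} :=
    Measure.map_apply_of_aemeasurable hZ.aemeasurable (measurableSet_singleton k)
  rw [measureReal_def, ← h, hZ.map_eq, ← measureReal_def, poissonMeasure_real_singleton,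
    Real.coe_toNNReal l hl, poisWt]

end Law

/-! ### Assembly: choice of the truncation point. -/

lemma etaParam_le {l θ : ℝ} (hθ : 0 ≤ θ) : etaParam l θ ≤ θ * (1 - Real.exp (-l)) := by
  rw [etaParam]
  split_ifs
  · exact le_rfl
  · exact mul_le_mul_of_nonneg_left (min_le_left _ _) hθ

lemma etaParam_pos {l θ : ℝ} (hl : 0 < l) (hθ : 0 < θ) (hθ1 : θ ≤ 1) : 0 < etaParam l θ := by
  have h1 : 0 < 1 - Real.exp (-l) := sub_pos.2 (by rw [← Real.exp_zero]; exact Real.exp_lt_exp.2 (by linarith))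
  rw [etaParam]
  split_ifs with h
  · positivity
  · have hlt : θ < 1 := lt_of_le_of_ne hθ1 h
    have hx1 : 0 < 1 - Real.sqrt θ := by
      rw [sub_pos, Real.sqrt_lt' one_pos]; simpa using hlt
    exact mul_pos hθ (lt_min h1 (by positivity))

/-- The entropy estimate, for the law of a Bernoulli sum given by its probability weights. -/
lemma entropy_sub_le_muParam {I : Type*} (s : Finset I) (hs : s.Nonempty) (p : I → ℝ)
    (h0 : ∀ i, 0 < p i) (h1 : ∀ i, p i ≤ 1) {l θ η M : ℝ} (hl : l = ∑ i ∈ s, p i)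
    (hθ : θ = (∑ i ∈ s, p i ^ 2) / l) (hη : η = etaParam l θ) (hM : M = bigM s.card η) :
    ∑' k, Real.negMulLog (poisWt l k) -
      ∑ k ∈ Finset.range (s.card + 1), Real.negMulLog (PowerSeries.coeff k (bernSer s p)) ≤
    η * Real.log (M - 1) + Real.binEntropy η + muParam l M := by
  set n := s.card with hn
  have hn1 : 1 ≤ n := hs.card_pos
  have hn1' : (1 : ℝ) ≤ n := by exact_mod_cast hn1
  have hl0 : 0 < l := by rw [hl]; exact Finset.sum_pos (fun i _ => h0 i) hs
  have hln : l ≤ n := by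
    rw [hl]
    refine (Finset.sum_le_sum fun i _ => h1 i).trans_eq ?_
    simp [hn]
  have hq : 0 < ∑ i ∈ s, p i ^ 2 := Finset.sum_pos (fun i _ => pow_pos (h0 i) 2) hs
  have hθ0 : 0 < θ := by rw [hθ]; positivity
  have hθ1 : θ ≤ 1 := by
    rw [hθ, div_le_one hl0, hl]
    refine Finset.sum_le_sum fun i _ => ?_
    have := mul_le_mul_of_nonneg_left (h1 i) (h0 i).le
    linarith
  have hexp : 0 < Real.exp (-l) := Real.exp_pos _
  have hη0 : 0 < η := by rw [hη]; exact etaParam_pos hl0 hθ0 hθ1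
  have hexp1 : Real.exp (-l) ≤ 1 := Real.exp_le_one_iff.2 (by linarith)
  have hηle : η ≤ 1 - Real.exp (-l) := by
    rw [hη]
    refine (etaParam_le hθ0.le).trans ?_
    nlinarith
  have hη1 : η < 1 := by linarith
  have hη1' : 0 < 1 - η := by linarith
  set d := bernTV s p l with hd
  have hd0 : 0 ≤ d := bernTV_nonneg s p l
  have hdη : d ≤ η := by
    rw [hη]
    exact bernTV_le_etaParam s p (fun i => (h0 i).le) h1 hl hl0 hq hθ hθ1
  have hMn : (n : ℝ) + 2 ≤ M := by rw [hM]; exact le_max_left _ _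
  have hMη : 1 ≤ M * (1 - η) := by
    rw [← div_le_iff₀ hη1', hM]; exact le_max_right _ _
  have hmono := binEntropy_add_mul_log_mono hd0 hdη hη0 hη1 hMη
  rcases le_or_gt (1 / (1 - η)) ((n : ℝ) + 2) with hc | hc
  · have hMeq : M = (n : ℝ) + 2 := by rw [hM]; exact max_eq_left hc
    have hent := entropy_sub_le s p (fun i => (h0 i).le) h1 hl0 (m := n + 2) (by omega) (by omega)
    have htail := tail_entropy_add_tail_le hl0 (n := n) (by omega)
      (poisTail_le_chernoff hl0 hln le_rfl)
    have hμ : muParam l M = (max (l * Real.log (Real.exp 1 / l)) 0 + l ^ 2 +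
        (6 * Real.log (2 * Real.pi) + 1) / 12) *
        Real.exp (-(l + n * Real.log (n / (l * Real.exp 1)))) := by
      rw [muParam, hMeq, add_sub_cancel_right]
    rw [hμ]
    have hlog : 0 ≤ poisTail l (n + 2) * Real.log (M - 1) :=
      mul_nonneg (poisTail_nonneg hl0.le _) (Real.log_nonneg (by linarith))
    -- Truncation is at n + 2 = M itself. Since log(M - 1) may be below 1 when n = 1, the term -T
    -- log(M - 1), with T the tail probability, is dropped and the extra T is charged to μ.
    have e : ((n + 2 : ℕ) : ℝ) - 1 = M - 1 := by rw [hMeq]; push_cast; ring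
    rw [e] at hent
    linarith
  · have hMeq : M = 1 / (1 - η) := by rw [hM]; exact max_eq_right hc.le
    -- This follows from η ≤ 1 - e^{-l}.
    have hMl : M ≤ Real.exp l := by
      rw [hMeq, div_le_iff₀ hη1']
      have h2 : Real.exp l * Real.exp (-l) = 1 := by rw [← Real.exp_add]; simp
      have h3 := mul_le_mul_of_nonneg_left (show Real.exp (-l) ≤ 1 - η by linarith)
        (Real.exp_nonneg l)
      linarith
    -- For n = 1 one has l ≤ 1, so M ≤ e < 3 = n + 2, contrary to the case at hand.
    have hn2 : 2 ≤ n := by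
      by_contra! hlt
      have hn' : n = 1 := by omega
      rw [hn', Nat.cast_one] at hln
      have h3 : Real.exp l ≤ Real.exp 1 := Real.exp_le_exp.2 hln
      have := Real.exp_one_lt_d9
      linarith
    have hM0 : 0 ≤ M := by linarith
    -- M need not be an integer, so truncation is at ⌊M⌋ = j + 2.
    obtain ⟨j, hj⟩ : ∃ j, ⌊M⌋₊ = j + 2 := by
      refine ⟨⌊M⌋₊ - 2, ?_⟩
      have : n + 2 ≤ ⌊M⌋₊ := Nat.le_floor (by push_cast; exact hMn)
      omega
    have hjn : n ≤ j := by
      have : n + 2 ≤ ⌊M⌋₊ := Nat.le_floor (by push_cast; exact hMn)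
      omega
    have hjn' : (n : ℝ) ≤ j := by exact_mod_cast hjn
    have hjM : (j : ℝ) + 2 ≤ M := by
      have := Nat.floor_le hM0
      rw [hj] at this
      push_cast at this
      exact this
    have hMj : M < (j : ℝ) + 3 := by
      have := Nat.lt_floor_add_one M
      rw [hj] at this
      push_cast at this
      linarith
    have hent := entropy_sub_le s p (fun i => (h0 i).le) h1 hl0 (m := j + 2) (by omega) (by omega)
    have htail := tail_entropy_le hl0 (n := j) (by linarith)
      ((Real.log_le_log (by positivity) hjM).trans
        ((Real.log_le_iff_le_exp (by linarith)).2 hMl))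
      (poisTail_le_chernoff hl0 (r := M - 2) (by linarith) (by push_cast; linarith))
    change _ ≤ muParam l M at htail
    have e : ((j + 2 : ℕ) : ℝ) - 1 = (j : ℝ) + 1 := by push_cast; ring
    rw [e] at hent
    -- With j ≥ n ≥ 2 this logarithm is at least 1, so -T log(j + 1) absorbs the extra tail
    -- probability T.
    have hlog1 : 1 ≤ Real.log ((j : ℝ) + 1) := by
      rw [Real.le_log_iff_exp_le (by positivity)]
      have h2 : (2 : ℝ) ≤ n := by exact_mod_cast hn2
      have := Real.exp_one_lt_d9
      linarith
    have hlogM : Real.log ((j : ℝ) + 1) ≤ Real.log (M - 1) :=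
      Real.log_le_log (by positivity) (by linarith)
    have hT := mul_le_mul_of_nonneg_left hlog1 (poisTail_nonneg hl0.le (j + 2))
    have hdl := mul_le_mul_of_nonneg_left hlogM hd0
    linarith

theorem proposition1 {I : Type*} [Fintype I] [Nonempty I]
    {Ω : Type*} [MeasurableSpace Ω] (P : Measure Ω) [IsProbabilityMeasure P]
    {Ω' : Type*} [MeasurableSpace Ω'] (Q : Measure Ω') [IsProbabilityMeasure Q]
    (p : I → ℝ) (hp : ∀ α, 0 < p α)
    (X : I → Ω → ℕ) (hX : ∀ α, Measurable (X α))
    (hX1 : ∀ α, P.real {ω | X α ω = 1} = p α)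
    (hX0 : ∀ α, P.real {ω | X α ω = 0} = 1 - p α)
    (hindep : iIndepFun X P)
    (W : Ω → ℕ) (hW : ∀ ω, W ω = ∑ α, X α ω)
    (Z : Ω' → ℕ) (hZ : HasLaw Z (poissonMeasure (sumMean p).toNNReal) Q)
    (n : ℕ) (hn : n = Fintype.card I)
    (lam θ η M μ : ℝ)
    (hlam : lam = sumMean p) (hθ : θ = thetaParam p) (hη : η = etaParam lam θ)
    (hM : M = bigM n η) (hμ : μ = muParam lam M) :
    Summable (entropyTerm P W) ∧ Summable (entropyTerm Q Z) ∧
      0 ≤ shannonEntropy Q Z - shannonEntropy P W ∧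
      shannonEntropy Q Z - shannonEntropy P W ≤
        η * Real.log (M - 1) + Real.binEntropy η + μ := by
  have hp1 : ∀ α, p α ≤ 1 := fun α => by
    have h : 0 ≤ P.real {ω | X α ω = 0} := measureReal_nonneg
    rw [hX0] at h
    linarith
  have hlam' : lam = ∑ α, p α := hlam
  have hlam0 : 0 < lam := by
    rw [hlam']; exact Finset.sum_pos (fun i _ => hp i) Finset.univ_nonempty
  have hθ' : θ = (∑ α, p α ^ 2) / lam := by rw [hθ, hlam, thetaParam]
  have hcard : (Finset.univ : Finset I).card = n := by rw [hn]; rfl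
  have hWt : entropyTerm P W =
      fun k => Real.negMulLog (PowerSeries.coeff k (bernSer Finset.univ p)) := by
    ext k
    rw [entropyTerm, ← measureReal_sum_eq_coeff P p X hX hX1 hX0 hindep Finset.univ k]
    simp only [hW]
  have hZt : entropyTerm Q Z = fun k => Real.negMulLog (poisWt lam k) := by
    ext k
    rw [entropyTerm, hlam, measureReal_eq_poisWt Q (hlam ▸ hlam0.le) Z hZ k]
  have hWs : HasSum (entropyTerm P W) (∑ k ∈ Finset.range ((Finset.univ : Finset I).card + 1),
      Real.negMulLog (PowerSeries.coeff k (bernSer (Finset.univ : Finset I) p))) := by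
    rw [hWt]
    refine hasSum_sum_of_ne_finset_zero fun k hk => ?_
    rw [Finset.mem_range, not_lt] at hk
    rw [coeff_bernSer_eq_zero _ p hk, Real.negMulLog_zero]
  have hZs : Summable (entropyTerm Q Z) := by
    rw [hZt]; exact summable_negMulLog_poisWt hlam0
  refine ⟨hWs.summable, hZs, ?_, ?_⟩
  · rw [shannonEntropy, shannonEntropy, hWs.tsum_eq, hZt, sub_nonneg]
    exact entropy_bernSer_le _ p (fun i => (hp i).le) hp1 hlam' hlam0
  · rw [shannonEntropy, shannonEntropy, hWs.tsum_eq, hZt, hμ]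
    exact entropy_sub_le_muParam Finset.univ Finset.univ_nonempty p hp hp1 hlam' hθ' hη
      (by rw [hcard]; exact hM)
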